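/- There is a universal constant $C>0$ such that for all integers $n,k\ge 1$ and every $0<\epsilon<1$ there is a quantum query algorithm (depending only on $n,k,\epsilon$) that makes at most $$C\cdot\frac{\sqrt n}{\epsilon^{1.5}}\,\log^{1.5}\!\Big(\frac n\epsilon\Big)\,\log^{+}\!\Big(\frac{\log n}{\epsilon}\Big)$$ calls to $U_p$ and $U_p^\dagger$ in total and has the following property. Let $p=(p_i)_{i=1}^n$ be any probability distribution on $[n]$, and let $U_p$ be any unitary on $\mathbb C^k\otimes\mathbb C^n$ giving purified quantum query access to $p$, that is, $$U_p|0\rangle|0\rangle=\sum_{i=1}^n\sqrt{p_i}\,|\phi_i\rangle|i\rangle$$ for some orthonormal vectors $|\phi_1\rangle,\dots,|\phi_n\rangle\in\mathbb C^k$. Then, run with the oracle $U_p$, the algorithm outputs a real number $\tilde H$ with $$\Pr\big[\,|\tilde H-H(p)|\le\epsilon\,\big]\ge \tfrac23,\qquad H(p)=\sum_{i=1}^n p_i\ln(1/p_i).$$ Here $\log$ is the natural logarithm, $\log^+x=\max\{0,\log x\}$ with $\log^+0=0$, and $|0\rangle$ denotes a fixed vector of the computational basis of each register. A quantum query algorithm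 is a circuit on $\mathbb C^k\otimes\mathbb C^n\otimes\mathbb C^w$ ($w$ any finite workspace dimension), started in $|0\rangle|0\rangle|0\rangle$, whose steps are oracle-independent unitaries and calls $U_p\otimes I$ or $U_p^\dagger\otimes I$, followed by a measurement in the computational basis and a classical function of the outcome. -/

import Mathlib

open scoped Matrix Kronecker

/-- Shannon entropy `H(p) = ∑ i, p i * ln (1 / p i)` in nats, with `0 * ln (1 / 0) = 0`. -/
noncomputable def shannonEntropy {n : ℕ} (p : Fin n → ℝ) : ℝ :=
  ∑ i, Real.negMulLog (p i)

/-- The computational basis vector `|i⟩`. -/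
def ket {ι : Type} [DecidableEq ι] (i : ι) : ι → ℂ := Pi.single i 1

/-- The tensor product `|φ⟩ ⊗ |ψ⟩`, in coordinates. -/
def tensorVec {ι κ : Type} (φ : ι → ℂ) (ψ : κ → ℂ) : ι × κ → ℂ := fun x => φ x.1 * ψ x.2

/-- `U` is a purified query oracle for the distribution `p` on an `n`-element set: a unitary on
`ℂ^k ⊗ ℂ^n` with `U |0⟩|0⟩ = ∑ i, √(p i) |φ i⟩|i⟩` for some orthonormal `φ 0, …, φ (n-1)`. -/
def IsPurifiedOracle {k n : ℕ} [NeZero k] [NeZero n] (p : Fin n → ℝ)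
    (U : Matrix.unitaryGroup (Fin k × Fin n) ℂ) : Prop :=
  ∃ φ : Fin n → EuclideanSpace ℂ (Fin k), Orthonormal ℂ φ ∧
    U.1 *ᵥ ket (0, 0) = ∑ i, (Real.sqrt (p i) : ℂ) • tensorVec (φ i : Fin k → ℂ) (ket i)

/-- Computational basis labels of `ℂ^k ⊗ ℂ^n ⊗ ℂ^w`: the two registers on which the oracle acts
and a workspace. -/
abbrev Register (k n w : ℕ) : Type := (Fin k × Fin n) × Fin w

/-- One step of a quantum query circuit: a fixed (oracle-independent) unitary on all registers,
a call to the oracle `U`, or a call to its inverse `U†`. -/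
inductive Instr (k n w : ℕ) : Type where
  | gate (V : Matrix.unitaryGroup (Register k n w) ℂ) : Instr k n w
  | call : Instr k n w
  | callInv : Instr k n w

/-- `U ⊗ I`: the oracle acting on the first two registers. -/
def liftOracle {k n w : ℕ} (U : Matrix.unitaryGroup (Fin k × Fin n) ℂ) :
    Matrix.unitaryGroup (Register k n w) ℂ :=
  ⟨U.1 ⊗ₖ (1 : Matrix (Fin w) (Fin w) ℂ),
    Matrix.kronecker_mem_unitary U.2 (one_mem _)⟩

/-- The unitary performed by one step, when the oracle is `U`. -/
def Instr.eval {k n w : ℕ} (U : Matrix.unitaryGroup (Fin k × Fin n) ℂ) :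
    Instr k n w → Matrix.unitaryGroup (Register k n w) ℂ
  | .gate V => V
  | .call => liftOracle U
  | .callInv => (liftOracle U)⁻¹

/-- The unitary performed by a circuit, whose steps are executed from the head of the list on. -/
def circuitEval {k n w : ℕ} (U : Matrix.unitaryGroup (Fin k × Fin n) ℂ) :
    List (Instr k n w) → Matrix.unitaryGroup (Register k n w) ℂ
  | [] => 1
  | s :: c => circuitEval U c * s.eval U

/-- The number of oracle calls made by one step. -/
def Instr.cost {k n w : ℕ} : Instr k n w → ℕ
  | .gate _ => 0
  | .call => 1
  | .callInv => 1

/-- A quantum query algorithm: a finite-dimensional workspace, a circuit, and a classical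
post-processing of the outcome of a final measurement in the computational basis. (Intermediate
measurements and classical control are covered, by deferring measurements to the end.) -/
structure QueryAlgorithm (k n : ℕ) where
  work : ℕ
  circuit : List (Instr k n (work + 1))
  output : Register k n (work + 1) → ℝ

namespace QueryAlgorithm

/-- The total number of calls to `U` and `U†`. -/
def queryCount {k n : ℕ} (alg : QueryAlgorithm k n) : ℕ :=
  (alg.circuit.map Instr.cost).sum

/-- The state before the measurement, when the circuit is started in `|0⟩|0⟩|0⟩`. -/
def finalState {k n : ℕ} [NeZero k] [NeZero n] (alg : QueryAlgorithm k n)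
    (U : Matrix.unitaryGroup (Fin k × Fin n) ℂ) : Register k n (alg.work + 1) → ℂ :=
  (circuitEval U alg.circuit).1 *ᵥ ket ((0, 0), 0)

open Classical in
/-- The probability (Born's rule) that the output of the algorithm lies in `S`. -/
noncomputable def outputProb {k n : ℕ} [NeZero k] [NeZero n] (alg : QueryAlgorithm k n)
    (U : Matrix.unitaryGroup (Fin k × Fin n) ℂ) (S : Set ℝ) : ℝ :=
  ∑ x with alg.output x ∈ S, ‖alg.finalState U x‖ ^ 2

end QueryAlgorithm

/-! If cos x = 1 - 2q, then |1 - r e^{ix}|² = (1 - r)² + 4rq, so the Fourier series of the logarithm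
of the left side expands a regularised ln(1/q) in the functions cos(m x) with coefficients r^m/m.
After weighting by q the regularisation costs at most (1 - r)²/(4r) per letter. Hence 1 - r of order
√(ε/n) and a truncation degree M of order √(n/ε) log(1/ε) give H(p) up to ε/2
(`abs_entropy_sub_le`).

Each cos(m arccos(1 - 2 p_i)) is the |0⟩|0⟩ matrix element of m steps of a product of two
reflections that uses U and U† once per step (`innerWalk_mulVec_ket`). One further call to U
prepares i with probability p_i, and an ancilla carries m with weight proportional to r^m/m. The
inner walks controlled on (i, m) form one reflection, whose expectation A in this state is the
required average divided by Λ = ∑ r^m/m, which is at most ln(1/(1 - r))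
(`star_dotProduct_controlledWalk`).

A second walk, built from that reflection and the one about the prepared state, has an orbit
satisfying the Chebyshev recurrence with parameter A. Phase estimation reads off A: the recurrence
and summation by parts bound the second moment of cos(2πj/T) - A by the energy of the window, with
no spectral decomposition (`sum_norm_sq_fourierMatrix_mul_le`, `exists_cosMean_estimator`). Accuracy
of order ε/Λ needs of order log(n/ε)/ε outer steps of O(M) queries each. When ln n < 2ε, the
constant (ln n)/2 is accurate enough and no query is made. -/

/-! ### Cosine-polynomial approximation of the entropy. -/

/-- Truncated Fourier expansion of the logarithm on a circle of radius `r < 1`. -/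
theorem abs_sum_pow_div_mul_cos_add_log_le {r : ℝ} (hr0 : 0 ≤ r) (hr1 : r < 1) (x : ℝ) (M : ℕ) :
    |∑ m ∈ Finset.range (M + 1), r ^ m / m * Real.cos (m * x)
        + Real.log (1 - 2 * r * Real.cos x + r ^ 2) / 2|
      ≤ r ^ (M + 1) * (1 - r)⁻¹ / (M + 1) := by
  -- The sum is minus the real part of the Taylor polynomial of log(1 + ·) at -z. The term m = 0
  -- vanishes because division by zero gives 0.
  set z : ℂ := r * Complex.exp (x * Complex.I) with hz
  have hnz : ‖z‖ = r := by simp [hz, Complex.norm_exp_ofReal_mul_I, abs_of_nonneg hr0]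
  have h := Complex.norm_log_sub_logTaylor_le M (z := -z) (by rw [norm_neg, hnz]; exact hr1)
  rw [norm_neg, hnz] at h
  refine le_trans ?_ h
  refine le_trans (le_of_eq ?_) (Complex.abs_re_le_norm _)
  congr 1
  rw [Complex.sub_re, Complex.log_re, Complex.logTaylor, Complex.re_sum]
  have hn : ‖1 + -z‖ ^ 2 = 1 - 2 * r * Real.cos x + r ^ 2 := by
    rw [← Complex.normSq_eq_norm_sq, Complex.normSq_apply]
    simp only [hz, Complex.exp_mul_I, ← Complex.ofReal_cos, ← Complex.ofReal_sin]
    simp [Complex.cos_ofReal_re, Complex.sin_ofReal_re]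
    nlinarith [Real.sin_sq_add_cos_sq x]
  rw [← hn, Real.log_pow, sub_eq_neg_add, ← Finset.sum_neg_distrib]
  push_cast
  congr 1
  · refine Finset.sum_congr rfl fun m _ => ?_
    have : (-1 : ℂ) ^ (m + 1) * (-z) ^ m / m
        = ((-(r ^ m / m) : ℝ) : ℂ) * Complex.exp ((m * x : ℝ) * Complex.I) := by
      have hm : Complex.exp ((m * x : ℝ) * Complex.I) = Complex.exp (x * Complex.I) ^ m := by
        rw [← Complex.exp_nat_mul]; push_cast; ring_nf
      rw [hm, hz, neg_pow ((r : ℂ) * _), mul_pow, pow_succ]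
      have : ((-1 : ℂ) ^ m) * (-1) ^ m = 1 := by rw [← mul_pow]; simp
      push_cast
      linear_combination (-(r : ℂ) ^ m * Complex.exp (x * Complex.I) ^ m / m) * this
    rw [this, Complex.re_ofReal_mul, Complex.exp_ofReal_mul_I_re]
    ring
  · ring

/-- The entropy of `p` as a combination of the quantities `cos (m * arccos (1 - 2 * p i))`. -/
theorem abs_entropy_sub_le {n : ℕ} {p : Fin n → ℝ} (hp : p ∈ stdSimplex ℝ (Fin n)) {r : ℝ}
    (hr0 : 1 / 2 ≤ r) (hr1 : r < 1) (M : ℕ) :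
    |2 * (∑ i, p i * ∑ m ∈ Finset.range (M + 1),
          r ^ m / m * Real.cos (m * Real.arccos (1 - 2 * p i)))
        + Real.log (4 * r) - shannonEntropy p|
      ≤ 2 * (r ^ (M + 1) * (1 - r)⁻¹ / (M + 1)) + n * (1 - r) ^ 2 / 2 := by
  obtain ⟨hp0, hp1⟩ := hp
  set τ := r ^ (M + 1) * (1 - r)⁻¹ / (M + 1) with hτ
  have hsum : 2 * (∑ i, p i * ∑ m ∈ Finset.range (M + 1),
          r ^ m / m * Real.cos (m * Real.arccos (1 - 2 * p i)))
        + Real.log (4 * r) - shannonEntropy p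
      = ∑ i, p i * (2 * (∑ m ∈ Finset.range (M + 1),
          r ^ m / m * Real.cos (m * Real.arccos (1 - 2 * p i)))
          + Real.log (4 * r) + Real.log (p i)) := by
    simp only [mul_add, Finset.sum_add_distrib, ← Finset.sum_mul, hp1, one_mul, shannonEntropy,
      Real.negMulLog, neg_mul, Finset.sum_neg_distrib, sub_neg_eq_add, Finset.mul_sum]
    congr 2
    refine Finset.sum_congr rfl fun i _ => Finset.sum_congr rfl fun m _ => by ring
  have hbound : ∀ i, |p i * (2 * (∑ m ∈ Finset.range (M + 1),
          r ^ m / m * Real.cos (m * Real.arccos (1 - 2 * p i)))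
          + Real.log (4 * r) + Real.log (p i))| ≤ p i * (2 * τ) + (1 - r) ^ 2 / 2 := by
    intro i
    rcases (hp0 i).eq_or_lt with h0 | h0
    · rw [← h0]; simp; positivity
    have hle : p i ≤ 1 := by
      rw [← hp1]; exact Finset.single_le_sum (fun j _ => hp0 j) (Finset.mem_univ i)
    have h := abs_sum_pow_div_mul_cos_add_log_le (by linarith) hr1 (Real.arccos (1 - 2 * p i)) M
    rw [Real.cos_arccos (by linarith) (by linarith), ← hτ] at h
    set s := ∑ m ∈ Finset.range (M + 1), r ^ m / m * Real.cos (m * Real.arccos (1 - 2 * p i))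
    -- The left side is 4r p_i + (1 - r)²; factoring out 4r p_i isolates ln p_i and leaves the bias
    -- l ≥ 0.
    have hq : 1 - 2 * r * (1 - 2 * p i) + r ^ 2 = 4 * r * p i * (1 + (1 - r) ^ 2 / (4 * r * p i)) := by
      field_simp; ring
    have hr : 0 < r := by linarith
    rw [hq, Real.log_mul (by positivity) (by positivity), Real.log_mul (by positivity) h0.ne'] at h
    set l := Real.log (1 + (1 - r) ^ 2 / (4 * r * p i)) with hl
    have hl0 : 0 ≤ l := Real.log_nonneg (by have : 0 ≤ (1 - r) ^ 2 / (4 * r * p i) := by positivity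
                                            linarith)
    have hl1 : p i * l ≤ (1 - r) ^ 2 / 2 := by
      have h1 : l ≤ (1 - r) ^ 2 / (4 * r * p i) := by
        have := Real.log_le_sub_one_of_pos
          (show 0 < 1 + (1 - r) ^ 2 / (4 * r * p i) by positivity)
        linarith
      calc p i * l ≤ p i * ((1 - r) ^ 2 / (4 * r * p i)) := by gcongr
        _ = (1 - r) ^ 2 / (4 * r) := by field_simp
        _ ≤ (1 - r) ^ 2 / 2 := by gcongr; linarith
    rw [abs_mul, abs_of_pos h0]
    rw [abs_le] at h
    have : |2 * s + Real.log (4 * r) + Real.log (p i)| ≤ 2 * τ + l := by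
      rw [abs_le]; constructor <;> linarith [h.1, h.2]
    calc _ ≤ p i * (2 * τ + l) := by gcongr
      _ ≤ _ := by linarith
  rw [hsum]
  calc _ ≤ ∑ i, |_| := Finset.abs_sum_le_sum_abs _ _
    _ ≤ ∑ i, (p i * (2 * τ) + (1 - r) ^ 2 / 2) := Finset.sum_le_sum fun i _ => hbound i
    _ = _ := by
      rw [Finset.sum_add_distrib, ← Finset.sum_mul, hp1]
      simp
      ring

/-- This total weight is the factor by which the normalised average must be rescaled, hence the loss
of precision in phase estimation. -/
theorem sum_pow_div_le_neg_log {r : ℝ} (hr0 : 0 ≤ r) (hr1 : r < 1) (M : ℕ) :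
    ∑ m ∈ Finset.range (M + 1), r ^ m / m ≤ -Real.log (1 - r) := by
  have h := Real.hasSum_pow_div_log_of_abs_lt_one (x := r) (by rw [abs_of_nonneg hr0]; exact hr1)
  rw [Finset.sum_range_succ']
  simpa using sum_le_hasSum (Finset.range M) (fun i _ => by positivity) h

theorem shannonEntropy_nonneg {n : ℕ} {p : Fin n → ℝ} (hp : p ∈ stdSimplex ℝ (Fin n)) :
    0 ≤ shannonEntropy p := by
  refine Finset.sum_nonneg fun i _ => Real.negMulLog_nonneg (hp.1 i) ?_
  rw [← hp.2]
  exact Finset.single_le_sum (fun j _ => hp.1 j) (Finset.mem_univ i)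

theorem shannonEntropy_le_log {n : ℕ} [NeZero n] {p : Fin n → ℝ}
    (hp : p ∈ stdSimplex ℝ (Fin n)) : shannonEntropy p ≤ Real.log n := by
  have hn : (0 : ℝ) < n := by exact_mod_cast Nat.pos_of_ne_zero (NeZero.ne n)
  have h := Real.concaveOn_negMulLog.le_map_sum (t := Finset.univ) (w := fun _ : Fin n => (n : ℝ)⁻¹)
    (p := p) (fun _ _ => by positivity) (by simp [hn.ne']) (fun i _ => hp.1 i)
  simp only [smul_eq_mul, ← Finset.mul_sum, hp.2, mul_one] at h
  rw [Real.negMulLog, Real.log_inv] at h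
  have h2 := mul_le_mul_of_nonneg_left h hn.le
  rw [← mul_assoc, mul_inv_cancel₀ hn.ne', one_mul] at h2
  calc shannonEntropy p ≤ _ := h2
    _ = Real.log n := by field_simp

/-! ### Windowed Fourier analysis of Chebyshev recurrences. -/

theorem star_dotProduct_self {ι : Type*} [Fintype ι] (v : ι → ℂ) :
    star v ⬝ᵥ v = ((∑ j, ‖v j‖ ^ 2 : ℝ) : ℂ) := by
  rw [dotProduct]
  push_cast
  refine Finset.sum_congr rfl fun j _ => ?_
  rw [Pi.star_apply, Complex.star_def, Complex.conj_mul']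

/-- Parseval's identity for a unitary matrix. -/
theorem sum_norm_sq_mulVec {ι : Type*} [Fintype ι] [DecidableEq ι] {F : Matrix ι ι ℂ}
    (hF : F ∈ Matrix.unitaryGroup ι ℂ) (v : ι → ℂ) :
    ∑ j, ‖(F *ᵥ v) j‖ ^ 2 = ∑ j, ‖v j‖ ^ 2 := by
  have : ((∑ j, ‖(F *ᵥ v) j‖ ^ 2 : ℝ) : ℂ) = ((∑ j, ‖v j‖ ^ 2 : ℝ) : ℂ) := by
    rw [← star_dotProduct_self, ← star_dotProduct_self, Matrix.star_mulVec, Matrix.dotProduct_mulVec, Matrix.vecMul_vecMul,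
      ← Matrix.star_eq_conjTranspose, Matrix.mem_unitaryGroup_iff'.mp hF, Matrix.vecMul_one]
  exact_mod_cast this

/-- The discrete Fourier transform on `T` points. -/
noncomputable def fourierMatrix (T : ℕ) : Matrix (Fin T) (Fin T) ℂ :=
  fun j t => (Complex.exp (2 * Real.pi * Complex.I / T))⁻¹ ^ (j.val * t.val) / (Real.sqrt T : ℂ)

theorem fourierMatrix_mem_unitaryGroup (T : ℕ) [NeZero T] :
    fourierMatrix T ∈ Matrix.unitaryGroup (Fin T) ℂ := by
  rw [Matrix.mem_unitaryGroup_iff]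
  set ζ : ℂ := (Complex.exp (2 * Real.pi * Complex.I / T))⁻¹ with hζ
  have hp : IsPrimitiveRoot ζ T := (Complex.isPrimitiveRoot_exp T (NeZero.ne T)).inv
  clear_value ζ
  have hn : ‖ζ‖ = 1 := hp.norm'_eq_one (NeZero.ne T)
  have hT : (0 : ℝ) < T := by exact_mod_cast Nat.pos_of_ne_zero (NeZero.ne T)
  have hT2 : (Real.sqrt T : ℂ) * Real.sqrt T = T := by
    rw [← Complex.ofReal_mul, Real.mul_self_sqrt hT.le]; simp
  have hT0 : (T : ℂ) ≠ 0 := by exact_mod_cast NeZero.ne T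
  have hinv : star ζ = ζ⁻¹ := by
    rw [Complex.inv_def, Complex.normSq_eq_norm_sq, hn]; simp
  have hζ0 : ζ ≠ 0 := hp.ne_zero (NeZero.ne T)
  ext j l
  rw [Matrix.mul_apply]
  have : ∀ t : Fin T, fourierMatrix T j t * star (fourierMatrix T) t l
      = (ζ ^ j.val * ζ⁻¹ ^ l.val) ^ t.val / T := by
    intro t
    rw [Matrix.star_apply, fourierMatrix, fourierMatrix, ← hζ, star_div₀, star_pow, hinv,
      div_mul_div_comm, Complex.star_def, Complex.conj_ofReal, hT2, mul_pow, ← pow_mul, ← pow_mul]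
  rw [Finset.sum_congr rfl fun t _ => this t, ← Finset.sum_div,
    Fin.sum_univ_eq_sum_range (fun t => (ζ ^ j.val * ζ⁻¹ ^ l.val) ^ t)]
  by_cases hjl : j = l
  · subst hjl
    rw [← mul_pow, mul_inv_cancel₀ hζ0]
    simp [hT0]
  · rw [Matrix.one_apply_ne hjl]
    have hne : ζ ^ j.val * ζ⁻¹ ^ l.val ≠ 1 := by
      intro h
      rw [inv_pow, mul_inv_eq_one₀ (pow_ne_zero _ hζ0)] at h
      exact hjl (Fin.ext (hp.pow_inj j.2 l.2 h))
    have hz : (ζ ^ j.val * ζ⁻¹ ^ l.val) ^ T = 1 := by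
      rw [mul_pow, ← pow_mul, ← pow_mul, mul_comm j.val, mul_comm l.val, pow_mul, pow_mul, inv_pow,
        hp.pow_eq_one]
      simp
    rw [geom_sum_eq hne, hz]
    simp

/-- If `u` satisfies the Chebyshev recurrence with parameter `A`, then the Fourier coefficients of
`α • u` are concentrated on the frequencies whose cosine is close to `A`, provided that the window
`α` is smooth. -/
theorem sum_norm_sq_fourierMatrix_mul_le {T : ℕ} [NeZero T] {α : ℕ → ℝ} (h0 : α 0 = 0)
    (hT : α T = 0) {A : ℝ} {u : ℕ → ℂ} (hu : ∀ t, u (t + 2) + u t = 2 * A * u (t + 1)) :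
    ∑ j : Fin T, ‖(fourierMatrix T *ᵥ fun t => α t * u t) j‖ ^ 2
        * (Real.cos (2 * Real.pi * j / T) - A) ^ 2
      ≤ ∑ t ∈ Finset.range T, (α (t + 1) - α t) ^ 2 * ((‖u (t + 1)‖ ^ 2 + ‖u t‖ ^ 2) / 2) := by
  set F := fourierMatrix T
  set ζ : ℂ := (Complex.exp (2 * Real.pi * Complex.I / T))⁻¹ with hζ
  have hp : IsPrimitiveRoot ζ T := (Complex.isPrimitiveRoot_exp T (NeZero.ne T)).inv
  clear_value ζ
  have hn : ‖ζ‖ = 1 := hp.norm'_eq_one (NeZero.ne T)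
  have hζ0 : ζ ≠ 0 := hp.ne_zero (NeZero.ne T)
  have hcos : ∀ j : ℕ, (ζ ^ j)⁻¹ + ζ ^ j = 2 * (Real.cos (2 * Real.pi * j / T) : ℝ) := by
    intro j
    rw [Complex.ofReal_cos, Complex.two_cos, hζ, inv_pow, inv_inv, ← Complex.exp_nat_mul,
      ← Complex.exp_neg]
    push_cast
    congr 2 <;> ring
  set a : Fin T → ℂ := fun t => (α (t + 1) - α t : ℝ) * u (t + 1) with ha
  set b : Fin T → ℂ := fun t => (α (t + 1) - α t : ℝ) * u t with hb
  have hsum : ∀ (w : ℕ → ℂ) (j : Fin T), (F *ᵥ fun t => w t) j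
      = (∑ t ∈ Finset.range T, (ζ ^ j.val) ^ t * w t) / (Real.sqrt T : ℂ) := by
    intro w j
    rw [Matrix.mulVec, dotProduct, Finset.sum_div,
      ← Fin.sum_univ_eq_sum_range (fun t => (ζ ^ j.val) ^ t * w t / (Real.sqrt T : ℂ))]
    refine Finset.sum_congr rfl fun t _ => ?_
    rw [← pow_mul, show F j t = ζ ^ (j.val * t.val) / (Real.sqrt T : ℂ) by rw [hζ]; rfl]
    ring
  -- Multiplication by 2cos = z⁻¹ + z shifts the sequence both ways, and the recurrence cancels
  -- everything except the increments of α.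
  have key : ∀ j : Fin T, 2 * ((Real.cos (2 * Real.pi * j / T) - A : ℝ) : ℂ)
      * (F *ᵥ fun t => α t * u t) j = (F *ᵥ a) j - ζ ^ j.val * (F *ᵥ b) j := by
    intro j
    rw [hsum (fun t => α t * u t), ha, hb, hsum (fun t => (α (t + 1) - α t : ℝ) * u (t + 1)),
      hsum (fun t => (α (t + 1) - α t : ℝ) * u t)]
    rw [mul_div_assoc', mul_div_assoc', ← sub_div]
    congr 1
    have hz0 : ζ ^ j.val ≠ 0 := pow_ne_zero _ hζ0
    rw [Complex.ofReal_sub, mul_sub, ← hcos]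
    simp only [Complex.ofReal_sub]
    set z := ζ ^ j.val
    -- The shift has no boundary term because α vanishes at 0 and at T.
    have shift : ∑ t ∈ Finset.range T, z ^ t * (α t * u t)
        = z * ∑ t ∈ Finset.range T, z ^ t * (α (t + 1) * u (t + 1)) := by
      have h1 := Finset.sum_range_succ (fun t => z ^ t * (α t * u t)) T
      rw [Finset.sum_range_succ'] at h1
      simp only [h0, hT, Complex.ofReal_zero, zero_mul, mul_zero, add_zero] at h1
      rw [← h1, Finset.mul_sum]
      refine Finset.sum_congr rfl fun t _ => ?_
      rw [pow_succ]; ring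
    have hrec : 2 * A * ∑ t ∈ Finset.range T, z ^ t * (α (t + 1) * u (t + 1))
        = (∑ t ∈ Finset.range T, z ^ t * (α t * u (t + 1))) * z⁻¹
          + ∑ t ∈ Finset.range T, z ^ t * (α (t + 1) * u t) := by
      have h1 := Finset.sum_range_succ (fun t => z ^ t * (α t * u (t + 1))) T
      rw [Finset.sum_range_succ'] at h1
      simp only [h0, hT, Complex.ofReal_zero, zero_mul, mul_zero, add_zero] at h1
      rw [← h1, Finset.sum_mul, Finset.mul_sum, ← Finset.sum_add_distrib]
      refine Finset.sum_congr rfl fun t _ => ?_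
      have : z ^ (t + 1) * (α (t + 1) * u (t + 1 + 1)) * z⁻¹
          = z ^ t * (α (t + 1) * u (t + 2)) := by
        rw [pow_succ]; field_simp
      rw [this]
      linear_combination (-(z ^ t * α (t + 1))) * hu t
    simp only [sub_mul, mul_sub, Finset.sum_sub_distrib]
    have e1 : ∑ t ∈ Finset.range T, z ^ t * (α t * u t) * z⁻¹
        = ∑ t ∈ Finset.range T, z ^ t * (α (t + 1) * u (t + 1)) := by
      rw [← Finset.sum_mul, shift]; field_simp
    rw [← Finset.sum_mul] at e1
    have e2 : 2 * (A : ℂ) * ∑ t ∈ Finset.range T, z ^ t * (α t * u t)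
        = ∑ t ∈ Finset.range T, z ^ t * (α t * u (t + 1))
          + z * ∑ t ∈ Finset.range T, z ^ t * (α (t + 1) * u t) := by
      rw [shift]
      calc _ = z * (2 * A * ∑ t ∈ Finset.range T, z ^ t * (α (t + 1) * u (t + 1))) := by ring
        _ = _ := by rw [hrec]; field_simp
    rw [e2, add_mul, mul_comm z⁻¹, e1]
    ring
  have hFm := fourierMatrix_mem_unitaryGroup T
  have bound : ∀ j : Fin T, ‖(F *ᵥ fun t => α t * u t) j‖ ^ 2
        * (Real.cos (2 * Real.pi * j / T) - A) ^ 2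
      ≤ (‖(F *ᵥ a) j‖ ^ 2 + ‖(F *ᵥ b) j‖ ^ 2) / 2 := by
    intro j
    have h1 := congrArg norm (key j)
    rw [norm_mul, norm_mul, Complex.norm_real, Complex.norm_ofNat] at h1
    have h2 := norm_sub_le ((F *ᵥ a) j) (ζ ^ j.val * (F *ᵥ b) j)
    rw [norm_mul, norm_pow, hn, one_pow, one_mul, ← h1] at h2
    rw [← sq_abs (Real.cos _ - A), ← Real.norm_eq_abs]
    set c := ‖Real.cos (2 * Real.pi * j / T) - A‖
    set d := ‖(F *ᵥ fun t => (α t : ℂ) * u t) j‖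
    have hcd : 0 ≤ 2 * c * d := by positivity
    have h3 := pow_le_pow_left₀ hcd h2 2
    nlinarith [sq_nonneg (‖(F *ᵥ a) j‖ - ‖(F *ᵥ b) j‖)]
  refine (Finset.sum_le_sum fun j _ => bound j).trans (le_of_eq ?_)
  rw [← Finset.sum_div, Finset.sum_add_distrib, sum_norm_sq_mulVec hFm, sum_norm_sq_mulVec hFm,
    ← Finset.sum_add_distrib, Finset.sum_div,
    ← Fin.sum_univ_eq_sum_range
      (fun t => (α (t + 1) - α t) ^ 2 * ((‖u (t + 1)‖ ^ 2 + ‖u t‖ ^ 2) / 2))]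
  refine Finset.sum_congr rfl fun t _ => ?_
  rw [ha, hb]
  simp only [norm_mul, Complex.norm_real, mul_pow, Real.norm_eq_abs, sq_abs]
  ring

/-- The triangular window: a unit vector that vanishes at both ends and varies slowly. -/
theorem exists_window {L : ℕ} (hL : 0 < L) :
    ∃ α : ℕ → ℝ, α 0 = 0 ∧ α (2 * L) = 0 ∧ ∑ t : Fin (2 * L), α t ^ 2 = 1 ∧
      ∑ t ∈ Finset.range (2 * L), (α (t + 1) - α t) ^ 2 ≤ 6 / (L : ℝ) ^ 2 := by
  set β : ℕ → ℝ := fun t => if t ≤ L then t else 2 * L - t with hβ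
  set s := ∑ t ∈ Finset.range (2 * L), β t ^ 2 with hs
  -- The descending half alone contributes 1² + ... + L² ≥ L³/3. The increments of β are ±1, so
  -- after normalisation their energy is 2L/s ≤ 6/L².
  have hs3 : (L : ℝ) ^ 3 / 3 ≤ s := by
    have h1 : ∀ K : ℕ, (K : ℝ) ^ 3 / 3 ≤ ∑ t ∈ Finset.range K, (t + 1 : ℝ) ^ 2 := by
      intro K
      induction K with
      | zero => simp
      | succ K ih =>
        rw [Finset.sum_range_succ]
        push_cast
        nlinarith [(Nat.cast_nonneg K : (0 : ℝ) ≤ K)]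
    have h2 : ∑ t ∈ Finset.range L, (t + 1 : ℝ) ^ 2 ≤ s := by
      rw [hs, two_mul, Finset.sum_range_add, ← Finset.sum_range_reflect]
      have : ∑ t ∈ Finset.range L, ((L - 1 - t : ℕ) + 1 : ℝ) ^ 2
          = ∑ t ∈ Finset.range L, β (L + t) ^ 2 := by
        refine Finset.sum_congr rfl fun t ht => ?_
        rw [Finset.mem_range] at ht
        simp only [hβ]
        rw [Nat.sub_sub, Nat.cast_sub (by omega)]
        split_ifs with h
        · have : t = 0 := by omega
          subst this; simp
        · push_cast; ring
      rw [this]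
      have : 0 ≤ ∑ t ∈ Finset.range L, β t ^ 2 := Finset.sum_nonneg fun t _ => sq_nonneg _
      linarith
    exact (h1 L).trans h2
  have hL0 : (0 : ℝ) < L := by exact_mod_cast hL
  have hs0 : 0 < s := lt_of_lt_of_le (by positivity) hs3
  have hsq : Real.sqrt s ^ 2 = s := Real.sq_sqrt hs0.le
  refine ⟨fun t => β t / Real.sqrt s, by simp [hβ], ?_, ?_, ?_⟩
  · simp only [hβ]
    rw [if_neg (by omega)]
    simp
  · rw [Fin.sum_univ_eq_sum_range (fun t => (β t / Real.sqrt s) ^ 2)]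
    simp only [div_pow, hsq]
    rw [← Finset.sum_div, ← hs, div_self hs0.ne']
  · have hd : ∀ t ∈ Finset.range (2 * L),
        (β (t + 1) / Real.sqrt s - β t / Real.sqrt s) ^ 2 ≤ 1 / s := by
      intro t _
      rw [← sub_div, div_pow, hsq]
      gcongr
      simp only [hβ]
      split_ifs with h1 h2 h2
      · push_cast; ring_nf; rfl
      · omega
      · have : t = L := by omega
        subst this; push_cast; ring_nf; rfl
      · push_cast; ring_nf; rfl
    refine (Finset.sum_le_sum hd).trans ?_
    rw [Finset.sum_const, Finset.card_range, nsmul_eq_mul, mul_one_div,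
      div_le_div_iff₀ hs0 (by positivity)]
    push_cast
    nlinarith

theorem mulVec_ket {ι : Type} [Fintype ι] [DecidableEq ι] (M : Matrix ι ι ℂ) (i : ι) :
    M *ᵥ ket i = fun j => M j i := by
  ext j
  simp [ket]

/-- Extend v to an orthonormal basis and use it as the columns. -/
theorem exists_unitary_mulVec_ket {ι : Type} [Fintype ι] [DecidableEq ι] (i : ι) {v : ι → ℂ}
    (hv : ∑ j, ‖v j‖ ^ 2 = 1) : ∃ G ∈ Matrix.unitaryGroup ι ℂ, G *ᵥ ket i = v := by
  have horth : Orthonormal ℂ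
      (({i} : Set ι).domRestrict fun _ => (WithLp.toLp 2 v : EuclideanSpace ℂ ι)) := by
    refine ⟨fun _ => ?_, fun a b hab => (hab (Subsingleton.elim a b)).elim⟩
    simpa [EuclideanSpace.norm_eq, Set.domRestrict] using hv
  obtain ⟨b, hb⟩ := horth.exists_orthonormalBasis_extension_of_card_eq (by simp)
  refine ⟨_, (EuclideanSpace.basisFun ι ℂ).toMatrix_orthonormalBasis_mem_unitary b, ?_⟩
  rw [mulVec_ket]
  ext j
  simp [Module.Basis.toMatrix_apply, hb i rfl]

/-! ### Query counting under classical control. -/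

section Implementable

variable {G X C D : Type} [Fintype X] [DecidableEq X]

/-- `Implementable L q F`: the oracle-dependent matrices `F c`, for all values `c` of a classical
control, are products of `q` oracle calls, which do not depend on `c`, and of oracle-independent
unitaries, which may depend on `c`. The oracle `U` acts by the matrix `L U`. -/
inductive Implementable (L : G → Matrix X X ℂ) : ℕ → (C → G → Matrix X X ℂ) → Prop
  | gate (V : C → Matrix X X ℂ) (hV : ∀ c, V c ∈ Matrix.unitaryGroup X ℂ) :
      Implementable L 0 fun c _ => V c
  | call : Implementable L 1 fun _ U => L U
  | callInv : Implementable L 1 fun _ U => (L U)ᴴ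
  | mul {q r : ℕ} {F F' : C → G → Matrix X X ℂ} (hF : Implementable L q F)
      (hF' : Implementable L r F') : Implementable L (q + r) fun c U => F c U * F' c U

namespace Implementable

variable {L : G → Matrix X X ℂ} {q : ℕ}

theorem conjTranspose {F : C → G → Matrix X X ℂ} (h : Implementable L q F) :
    Implementable L q fun c U => (F c U)ᴴ := by
  induction h with
  | gate V hV => exact gate (fun c => (V c)ᴴ) fun c => Unitary.star_mem (hV c)
  | call => exact callInv
  | callInv => simpa using call
  | mul _ _ ih ih' => simpa [Nat.add_comm] using mul ih' ih

/-- Controlled powers of matrices whose controlled versions are implementable. -/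
theorem pow_min {R : C → G → Matrix X X ℂ}
    (h : ∀ P : C → Prop, ∀ [DecidablePred P],
      Implementable L q fun c U => if P c then R c U else 1) (m : C → ℕ) (s : ℕ) :
    Implementable L (s * q) fun c U => R c U ^ min s (m c) := by
  induction s with
  | zero => simpa using gate (L := L) (fun _ : C => 1) fun _ => one_mem _
  | succ s ih =>
    convert mul (h fun c => s < m c) ih using 1
    · ring
    · ext1 c
      ext1 U
      split_ifs with hs
      · rw [min_eq_left hs, min_eq_left hs.le, pow_succ']
      · rw [min_eq_right (by omega), min_eq_right (by omega), one_mul]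

/-- Part of the classical control becomes a quantum register. This costs no extra queries because
the calls are the same for all control values; only the gates vary from block to block. -/
theorem blockDiagonal [Fintype D] [DecidableEq D] {F : C × D → G → Matrix X X ℂ}
    (h : Implementable L q F) :
    Implementable (fun U => Matrix.blockDiagonal fun _ : D => L U) q
      fun c U => Matrix.blockDiagonal fun d => F (c, d) U := by
  induction h with
  | gate V hV =>
    refine gate (fun c => Matrix.blockDiagonal fun d => V (c, d)) fun c => ?_
    rw [Matrix.mem_unitaryGroup_iff, Matrix.star_eq_conjTranspose,
      Matrix.blockDiagonal_conjTranspose, ← Matrix.blockDiagonal_mul, ← Matrix.blockDiagonal_one]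
    congr 1
    ext1 d
    exact Matrix.mem_unitaryGroup_iff.mp (hV (c, d))
  | call => exact call
  | callInv =>
    simpa [Matrix.blockDiagonal_conjTranspose] using
      callInv (C := C) (L := fun U => Matrix.blockDiagonal fun _ : D => L U)
  | mul _ _ ih ih' => simpa [Matrix.blockDiagonal_mul] using mul ih ih'

end Implementable

end Implementable

theorem circuitEval_append {k n w : ℕ} (U : Matrix.unitaryGroup (Fin k × Fin n) ℂ)
    (c d : List (Instr k n w)) : circuitEval U (c ++ d) = circuitEval U d * circuitEval U c := by
  induction c with
  | nil => simp [circuitEval]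
  | cons s c ih => simp [circuitEval, ih, mul_assoc]

theorem Implementable.exists_circuit {k n w : ℕ} {X : Type} [Fintype X] [DecidableEq X]
    {L : Matrix.unitaryGroup (Fin k × Fin n) ℂ → Matrix X X ℂ} (e : Register k n w ≃ X)
    (hL : ∀ U, (L U).submatrix e e = (liftOracle U).1) {q : ℕ}
    {F : Unit → Matrix.unitaryGroup (Fin k × Fin n) ℂ → Matrix X X ℂ}
    (h : Implementable L q F) :
    ∃ c : List (Instr k n w), (c.map Instr.cost).sum = q ∧
      ∀ U, (circuitEval U c).1 = (F () U).submatrix e e := by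
  induction h with
  | gate V hV =>
    refine ⟨[.gate ⟨(V ()).submatrix e e, ?_⟩], rfl, fun U => ?_⟩
    · rw [Matrix.mem_unitaryGroup_iff, Matrix.star_eq_conjTranspose, Matrix.conjTranspose_submatrix,
        Matrix.submatrix_mul_equiv, ← Matrix.star_eq_conjTranspose,
        Matrix.mem_unitaryGroup_iff.mp (hV ()), Matrix.submatrix_one_equiv]
    · simp [circuitEval, Instr.eval]
  | call => exact ⟨[.call], rfl, fun U => by simp [circuitEval, Instr.eval, hL]⟩
  | callInv =>
    refine ⟨[.callInv], rfl, fun U => ?_⟩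
    rw [← Matrix.conjTranspose_submatrix, hL]
    simp [circuitEval, Instr.eval, Matrix.star_eq_conjTranspose]
  | mul _ _ ih ih' =>
    obtain ⟨c, hc, hc'⟩ := ih
    obtain ⟨d, hd, hd'⟩ := ih'
    -- The right factor of a matrix product acts first, so its circuit heads the list.
    refine ⟨d ++ c, by simp [hc, hd, Nat.add_comm], fun U => ?_⟩
    rw [circuitEval_append, Submonoid.coe_mul, hc', hd', Matrix.submatrix_mul_equiv]

/-! ### Products of two reflections and Chebyshev polynomials. -/

section Reflection

variable {X : Type} [DecidableEq X]

/-- The reflection `2|v⟩⟨v| - 1`. -/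
def reflectionMatrix (v : X → ℂ) : Matrix X X ℂ :=
  (2 : ℂ) • Matrix.vecMulVec v (star v) - 1

theorem reflectionMatrix_conjTranspose (v : X → ℂ) :
    (reflectionMatrix v)ᴴ = reflectionMatrix v := by
  simp [reflectionMatrix, Matrix.conjTranspose_vecMulVec]

variable [Fintype X]

theorem reflectionMatrix_mulVec (v w : X → ℂ) :
    reflectionMatrix v *ᵥ w = (2 * (star v ⬝ᵥ w)) • v - w := by
  rw [reflectionMatrix, Matrix.sub_mulVec, Matrix.one_mulVec, Matrix.smul_mulVec,
    Matrix.vecMulVec_mulVec, op_smul_eq_smul, smul_smul]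

theorem reflectionMatrix_mul_self {v : X → ℂ} (hv : star v ⬝ᵥ v = 1) :
    reflectionMatrix v * reflectionMatrix v = 1 := by
  have : Matrix.vecMulVec v (star v) * Matrix.vecMulVec v (star v)
      = Matrix.vecMulVec v (star v) := by
    rw [Matrix.vecMulVec_mul_vecMulVec, hv, one_smul]
  rw [reflectionMatrix]
  simp only [sub_mul, mul_sub, mul_one, one_mul, smul_mul_assoc, mul_smul_comm, this]
  module

theorem reflectionMatrix_mem_unitaryGroup {v : X → ℂ} (hv : star v ⬝ᵥ v = 1) :
    reflectionMatrix v ∈ Matrix.unitaryGroup X ℂ := by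
  rw [Matrix.mem_unitaryGroup_iff, Matrix.star_eq_conjTranspose, reflectionMatrix_conjTranspose,
    reflectionMatrix_mul_self hv]

theorem mul_reflectionMatrix_mul_conjTranspose {B : Matrix X X ℂ}
    (hB : B ∈ Matrix.unitaryGroup X ℂ) (v : X → ℂ) :
    B * reflectionMatrix v * Bᴴ = reflectionMatrix (B *ᵥ v) := by
  have h1 : B * Bᴴ = 1 := Matrix.mem_unitaryGroup_iff.mp hB
  rw [reflectionMatrix, reflectionMatrix, mul_sub, sub_mul, mul_one, h1, mul_smul_comm,
    smul_mul_assoc, Matrix.mul_vecMulVec, Matrix.vecMulVec_mul, Matrix.star_mulVec]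

theorem star_dotProduct_mulVec_self {B : Matrix X X ℂ} (hB : B ∈ Matrix.unitaryGroup X ℂ)
    (v : X → ℂ) : star (B *ᵥ v) ⬝ᵥ (B *ᵥ v) = star v ⬝ᵥ v := by
  rw [Matrix.star_mulVec, Matrix.dotProduct_mulVec, Matrix.vecMul_vecMul,
    ← Matrix.star_eq_conjTranspose, Matrix.mem_unitaryGroup_iff'.mp hB, Matrix.vecMul_one]

/-- The orbit of `v` under the product of the reflection about `v` and a reflection `S` satisfies
the Chebyshev recurrence. -/
theorem walk_recurrence {S : Matrix X X ℂ} (hS2 : S * S = 1) {v : X → ℂ}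
    (hv : star v ⬝ᵥ v = 1) (t : ℕ) :
    (reflectionMatrix v * S) ^ (t + 2) *ᵥ v + (reflectionMatrix v * S) ^ t *ᵥ v
      = (2 * (star v ⬝ᵥ (S *ᵥ v))) • ((reflectionMatrix v * S) ^ (t + 1) *ᵥ v) := by
  set R := reflectionMatrix v * S with hR
  -- S times the reflection is R⁻¹. Since the reflection fixes v, R v + R⁻¹ v is a multiple of v;
  -- applying R^(t+1) gives the recurrence.
  have h1 : R * (S * reflectionMatrix v) = 1 := by
    rw [hR, mul_assoc, ← mul_assoc S, hS2, one_mul, reflectionMatrix_mul_self hv]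
  have h2 : R *ᵥ v + (S * reflectionMatrix v) *ᵥ v = (2 * (star v ⬝ᵥ (S *ᵥ v))) • v := by
    rw [hR, ← Matrix.mulVec_mulVec, ← Matrix.mulVec_mulVec, reflectionMatrix_mulVec,
      reflectionMatrix_mulVec, hv, mul_one, two_smul, add_sub_cancel_right, sub_add_cancel]
  rw [← Matrix.mulVec_smul, ← h2, Matrix.mulVec_add, Matrix.mulVec_mulVec, Matrix.mulVec_mulVec,
    ← pow_succ, pow_succ R t, mul_assoc (R ^ t), h1, mul_one]

theorem walk_dotProduct_eq_cos {S : Matrix X X ℂ} (hS2 : S * S = 1) {v : X → ℂ}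
    (hv : star v ⬝ᵥ v = 1) {c : ℝ} (hc : star v ⬝ᵥ (S *ᵥ v) = c) (hc1 : -1 ≤ c) (hc2 : c ≤ 1)
    (m : ℕ) :
    star v ⬝ᵥ ((reflectionMatrix v * S) ^ m *ᵥ v) = (Real.cos (m * Real.arccos c) : ℝ) := by
  induction m using Nat.twoStepInduction with
  | zero => simp [hv]
  | one =>
    rw [pow_one, ← Matrix.mulVec_mulVec, reflectionMatrix_mulVec, dotProduct_sub,
      dotProduct_smul, hv, hc, Nat.cast_one, one_mul, Real.cos_arccos hc1 hc2, smul_eq_mul]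
    ring
  | more m ih ih' =>
    have h := congrArg (star v ⬝ᵥ ·) (walk_recurrence hS2 hv m)
    simp only [dotProduct_add, dotProduct_smul, smul_eq_mul, ih, ih', hc] at h
    rw [eq_sub_of_add_eq h]
    have h3 : Real.cos ((m + 2 : ℕ) * Real.arccos c)
        = 2 * c * Real.cos ((m + 1 : ℕ) * Real.arccos c) - Real.cos (m * Real.arccos c) := by
      have e1 : ((m + 2 : ℕ) : ℝ) * Real.arccos c
          = (m + 1 : ℕ) * Real.arccos c + Real.arccos c := by push_cast; ring
      have e2 : (m : ℝ) * Real.arccos c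
          = (m + 1 : ℕ) * Real.arccos c - Real.arccos c := by push_cast; ring
      rw [e1, e2, Real.cos_add, Real.cos_sub, Real.cos_arccos hc1 hc2]
      ring
    rw [h3]
    push_cast
    ring

/-- The word is a palindrome in self-adjoint letters. The extra final reflection thus turns a walk
power into an involution, which can itself serve as the reflection S of another walk. -/
theorem walk_pow_mul_reflectionMatrix_conjTranspose {S : Matrix X X ℂ} (hS : Sᴴ = S)
    (v : X → ℂ) (m : ℕ) :
    ((reflectionMatrix v * S) ^ m * reflectionMatrix v)ᴴ
      = (reflectionMatrix v * S) ^ m * reflectionMatrix v := by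
  have h : SemiconjBy (reflectionMatrix v) (S * reflectionMatrix v) (reflectionMatrix v * S) := by
    rw [SemiconjBy, mul_assoc]
  rw [Matrix.conjTranspose_mul, Matrix.conjTranspose_pow, Matrix.conjTranspose_mul,
    reflectionMatrix_conjTranspose, hS]
  exact (h.pow_right m).eq

theorem walk_pow_mul_reflectionMatrix_mul_self {S : Matrix X X ℂ} (hS : Sᴴ = S) (hS2 : S * S = 1)
    {v : X → ℂ} (hv : star v ⬝ᵥ v = 1) (m : ℕ) :
    ((reflectionMatrix v * S) ^ m * reflectionMatrix v)
      * ((reflectionMatrix v * S) ^ m * reflectionMatrix v) = 1 := by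
  have hmem : (reflectionMatrix v * S) ^ m * reflectionMatrix v ∈ Matrix.unitaryGroup X ℂ := by
    have h := reflectionMatrix_mem_unitaryGroup hv
    have hS' : S ∈ Matrix.unitaryGroup X ℂ := by
      rw [Matrix.mem_unitaryGroup_iff, Matrix.star_eq_conjTranspose, hS, hS2]
    exact mul_mem (pow_mem (mul_mem h hS') m) h
  have h := Matrix.mem_unitaryGroup_iff.mp hmem
  rwa [Matrix.star_eq_conjTranspose, walk_pow_mul_reflectionMatrix_conjTranspose hS] at h

end Reflection

theorem blockDiagonal_mulVec {X D : Type} [Fintype X] [Fintype D] [DecidableEq D]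
    (M : D → Matrix X X ℂ) (v : X × D → ℂ) (x : X) (d : D) :
    (Matrix.blockDiagonal M *ᵥ v) (x, d) = (M d *ᵥ fun y => v (y, d)) x := by
  simp [Matrix.mulVec, dotProduct, Fintype.sum_prod_type, Matrix.blockDiagonal_apply, ite_mul]

theorem one_kronecker_mulVec {X D : Type} [Fintype X] [Fintype D] [DecidableEq X]
    (M : Matrix D D ℂ) (v : X × D → ℂ) (x : X) (d : D) :
    (((1 : Matrix X X ℂ) ⊗ₖ M) *ᵥ v) (x, d) = (M *ᵥ fun y => v (x, y)) d := by
  simp only [Matrix.mulVec, dotProduct, Fintype.sum_prod_type, Matrix.kroneckerMap_apply,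
    Matrix.one_apply, ite_mul, one_mul, zero_mul]
  rw [Finset.sum_eq_single x]
  · simp
  · intro b _ hb
    simp [hb.symm]
  · simp

theorem star_ket_dotProduct {ι : Type} [Fintype ι] [DecidableEq ι] (i : ι) (v : ι → ℂ) :
    star (ket i) ⬝ᵥ v = v i := by
  have : star (ket i) = ket i := by rw [ket, ← Pi.single_star, star_one]
  rw [this, ket, single_one_dotProduct]

theorem ket_prod {ι κ : Type} [DecidableEq ι] [DecidableEq κ] (i : ι) (j : κ) :
    ket (i, j) = fun x => ket i x.1 * ket j x.2 := by
  ext ⟨a, b⟩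
  by_cases h1 : a = i <;> by_cases h2 : b = j <;> simp [ket, h1, h2]

theorem star_ket_dotProduct_ket {ι : Type} [Fintype ι] [DecidableEq ι] (i : ι) :
    star (ket i) ⬝ᵥ ket i = 1 := by
  rw [star_ket_dotProduct]; simp [ket]

/-! ### The inner walk, encoding Chebyshev polynomials of a single probability. -/

section InnerWalk

variable {k n : ℕ}

/-- The reflection `1 - 2 U†(1 ⊗ |i⟩⟨i|)U`. -/
noncomputable def markedReflection (U : Matrix.unitaryGroup (Fin k × Fin n) ℂ) (i : Fin n) :
    Matrix (Fin k × Fin n) (Fin k × Fin n) ℂ :=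
  U.1ᴴ * Matrix.diagonal (fun a => if a.2 = i then -1 else 1) * U.1

theorem diagonal_ite_mul_self (i : Fin n) :
    Matrix.diagonal (fun a : Fin k × Fin n => if a.2 = i then (-1 : ℂ) else 1)
      * Matrix.diagonal (fun a => if a.2 = i then -1 else 1) = 1 := by
  rw [Matrix.diagonal_mul_diagonal, ← Matrix.diagonal_one]
  congr 1
  ext a
  split_ifs <;> simp

theorem diagonal_ite_conjTranspose (i : Fin n) :
    (Matrix.diagonal (fun a : Fin k × Fin n => if a.2 = i then (-1 : ℂ) else 1))ᴴ
      = Matrix.diagonal (fun a => if a.2 = i then -1 else 1) := by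
  rw [Matrix.diagonal_conjTranspose]
  congr 1
  ext a
  rw [Pi.star_apply]
  split_ifs <;> simp

theorem markedReflection_conjTranspose (U : Matrix.unitaryGroup (Fin k × Fin n) ℂ) (i : Fin n) :
    (markedReflection U i)ᴴ = markedReflection U i := by
  rw [markedReflection, Matrix.conjTranspose_mul, Matrix.conjTranspose_mul,
    diagonal_ite_conjTranspose, Matrix.conjTranspose_conjTranspose, mul_assoc]

theorem markedReflection_mul_self (U : Matrix.unitaryGroup (Fin k × Fin n) ℂ) (i : Fin n) :
    markedReflection U i * markedReflection U i = 1 := by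
  have h1 : U.1 * U.1ᴴ = 1 := Matrix.mem_unitaryGroup_iff.mp U.2
  have h2 : U.1ᴴ * U.1 = 1 := Matrix.mem_unitaryGroup_iff'.mp U.2
  rw [markedReflection]
  set d := Matrix.diagonal (fun a : Fin k × Fin n => if a.2 = i then (-1 : ℂ) else 1) with hd
  have hdd : d * d = 1 := diagonal_ite_mul_self i
  calc U.1ᴴ * d * U.1 * (U.1ᴴ * d * U.1) = U.1ᴴ * (d * (U.1 * U.1ᴴ) * d) * U.1 := by
        simp only [mul_assoc]
    _ = 1 := by rw [h1, mul_one, hdd, mul_one, h2]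

variable [NeZero k] [NeZero n]

/-- The probability of `i` in the second register of `U|0⟩|0⟩`. -/
noncomputable def oracleProb (U : Matrix.unitaryGroup (Fin k × Fin n) ℂ) (i : Fin n) : ℝ :=
  ∑ j, ‖(U.1 *ᵥ ket (0, 0)) (j, i)‖ ^ 2

theorem IsPurifiedOracle.oracleProb_eq {p : Fin n → ℝ}
    {U : Matrix.unitaryGroup (Fin k × Fin n) ℂ} (h : IsPurifiedOracle p U)
    (hp : ∀ i, 0 ≤ p i) (i : Fin n) : oracleProb U i = p i := by
  obtain ⟨φ, hφ, hU⟩ := h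
  have h1 : ∑ j, ‖φ i j‖ ^ 2 = 1 := by
    rw [← EuclideanSpace.norm_sq_eq, hφ.norm_eq_one, one_pow]
  have h2 : ∀ j, (U.1 *ᵥ ket (0, 0)) (j, i) = Real.sqrt (p i) * φ i j := by
    intro j
    rw [hU, Finset.sum_apply, Finset.sum_eq_single i]
    · simp [tensorVec, ket]
    · intro b _ hb
      simp [tensorVec, ket, hb]
    · simp
  simp_rw [oracleProb, h2, norm_mul, mul_pow, Complex.norm_real, Real.norm_eq_abs, sq_abs,
    Real.sq_sqrt (hp i)]
  rw [← Finset.mul_sum, h1, mul_one]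

theorem sum_norm_sq_oracle (U : Matrix.unitaryGroup (Fin k × Fin n) ℂ) :
    ∑ a, ‖(U.1 *ᵥ ket (0, 0)) a‖ ^ 2 = 1 := by
  rw [sum_norm_sq_mulVec U.2]
  have h := star_ket_dotProduct_ket ((0, 0) : Fin k × Fin n)
  rw [star_dotProduct_self] at h
  exact_mod_cast h

theorem star_ket_dotProduct_markedReflection (U : Matrix.unitaryGroup (Fin k × Fin n) ℂ)
    (i : Fin n) :
    star (ket (0, 0)) ⬝ᵥ (markedReflection U i *ᵥ ket (0, 0))
      = ((1 - 2 * oracleProb U i : ℝ) : ℂ) := by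
  set ψ := U.1 *ᵥ ket (0, 0) with hψ
  have h1 : star (ket (0, 0)) ⬝ᵥ (markedReflection U i *ᵥ ket (0, 0))
      = star ψ ⬝ᵥ (Matrix.diagonal (fun a => if a.2 = i then -1 else 1) *ᵥ ψ) := by
    rw [markedReflection, ← Matrix.mulVec_mulVec, ← Matrix.mulVec_mulVec, ← hψ,
      Matrix.dotProduct_mulVec, ← Matrix.star_mulVec]
  have h2 : (1 : ℝ) = ∑ a : Fin k × Fin n, ‖ψ a‖ ^ 2 := (sum_norm_sq_oracle U).symm
  have h3 : oracleProb U i = ∑ a : Fin k × Fin n, if a.2 = i then ‖ψ a‖ ^ 2 else 0 := by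
    rw [Fintype.sum_prod_type, oracleProb]
    refine Finset.sum_congr rfl fun j _ => ?_
    simp [hψ]
  rw [h1, h3, h2, Finset.mul_sum, ← Finset.sum_sub_distrib, dotProduct]
  push_cast
  refine Finset.sum_congr rfl fun a _ => ?_
  rw [Matrix.mulVec_diagonal, Pi.star_apply, Complex.star_def, mul_left_comm, Complex.conj_mul']
  split_ifs <;> push_cast <;> ring

/-- A reflection whose matrix element at `|0⟩|0⟩` is a Chebyshev polynomial of the probability
of `i`. -/
noncomputable def innerWalk (U : Matrix.unitaryGroup (Fin k × Fin n) ℂ) (i : Fin n) (m : ℕ) :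
    Matrix (Fin k × Fin n) (Fin k × Fin n) ℂ :=
  (reflectionMatrix (ket (0, 0)) * markedReflection U i) ^ m * reflectionMatrix (ket (0, 0))

/-- The final reflection fixes |0⟩|0⟩, so it does not affect this matrix element. -/
theorem innerWalk_mulVec_ket (U : Matrix.unitaryGroup (Fin k × Fin n) ℂ) (i : Fin n) (m : ℕ) :
    (innerWalk U i m *ᵥ ket (0, 0)) (0, 0)
      = (Real.cos (m * Real.arccos (1 - 2 * oracleProb U i)) : ℝ) := by
  have h0 : 0 ≤ oracleProb U i := Finset.sum_nonneg fun _ _ => sq_nonneg _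
  have h1 : oracleProb U i ≤ 1 := by
    rw [← sum_norm_sq_oracle U, Fintype.sum_prod_type, oracleProb]
    exact Finset.sum_le_sum fun j _ => Finset.single_le_sum
      (f := fun i => ‖(U.1 *ᵥ ket (0, 0)) (j, i)‖ ^ 2) (fun _ _ => sq_nonneg _) (Finset.mem_univ i)
  have h2 : reflectionMatrix (ket (0, 0)) *ᵥ ket ((0, 0) : Fin k × Fin n) = ket (0, 0) := by
    rw [reflectionMatrix_mulVec, star_ket_dotProduct_ket, mul_one, two_smul, add_sub_cancel_right]
  rw [← star_ket_dotProduct (0, 0) (innerWalk U i m *ᵥ ket (0, 0)), innerWalk, ← Matrix.mulVec_mulVec, h2]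
  exact walk_dotProduct_eq_cos (markedReflection_mul_self U i) (star_ket_dotProduct_ket _)
    (star_ket_dotProduct_markedReflection U i) (by linarith) (by linarith) m

/-- Only the gates are controlled: if the diagonal between U† and U is replaced by 1, the two calls
cancel. Each step therefore costs two calls whether or not it is active. -/
theorem implementable_innerWalk {C : Type} (P : C → Prop) [DecidablePred P] (i : C → Fin n)
    (m : C → ℕ) (M : ℕ) (hm : ∀ c, m c ≤ M) :
    Implementable (fun U : Matrix.unitaryGroup (Fin k × Fin n) ℂ => U.1) (M * 2)
      fun c U => if P c then innerWalk U (i c) (m c) else 1 := by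
  have hr := reflectionMatrix_mem_unitaryGroup
    (star_ket_dotProduct_ket ((0, 0) : Fin k × Fin n))
  have hstep : ∀ Q : C → Prop, ∀ [DecidablePred Q],
      Implementable (fun U : Matrix.unitaryGroup (Fin k × Fin n) ℂ => U.1) 2
        fun c U => if Q c then reflectionMatrix (ket (0, 0)) * markedReflection U (i c) else 1 := by
    intro Q _
    have hg1 := Implementable.gate (L := fun U : Matrix.unitaryGroup (Fin k × Fin n) ℂ => U.1)
      (fun c => if Q c then reflectionMatrix (ket (0, 0)) else 1)
      (fun c => by split_ifs; exacts [hr, one_mem _])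
    have hg2 := Implementable.gate (L := fun U : Matrix.unitaryGroup (Fin k × Fin n) ℂ => U.1)
      (fun c => if Q c then Matrix.diagonal (fun a => if a.2 = i c then -1 else 1) else 1)
      (fun c => by
        split_ifs
        · rw [Matrix.mem_unitaryGroup_iff, Matrix.star_eq_conjTranspose,
            diagonal_ite_conjTranspose, diagonal_ite_mul_self]
        · exact one_mem _)
    convert hg1.mul ((Implementable.callInv.mul hg2).mul Implementable.call) using 1
    ext1 c
    ext1 U
    by_cases hQ : Q c
    · simp only [if_pos hQ, markedReflection]
    · simp only [if_neg hQ, mul_one, one_mul]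
      exact (Matrix.mem_unitaryGroup_iff'.mp U.2).symm
  have hg := Implementable.gate (L := fun U : Matrix.unitaryGroup (Fin k × Fin n) ℂ => U.1)
    (fun c => if P c then reflectionMatrix (ket (0, 0)) else 1)
    (fun c => by split_ifs; exacts [hr, one_mem _])
  have h : Implementable _ (M * 2) _ :=
    (Implementable.pow_min hstep (fun c => if P c then m c else 0) M).mul hg
  convert h using 1
  ext1 c
  ext1 U
  by_cases hP : P c
  · simp only [if_pos hP, innerWalk, min_eq_right (hm c)]
  · simp [if_neg hP]

end InnerWalk

/-! ### State preparation and the outer walk. -/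

section Preparation

variable {A D : Type} [Fintype A] [DecidableEq A] [Fintype D] [DecidableEq D]

/-- The exchange of the first two of three registers. -/
def exchangeMatrix (A D : Type) [DecidableEq A] [DecidableEq D] :
    Matrix (A × A × D) (A × A × D) ℂ :=
  (1 : Matrix (A × A × D) (A × A × D) ℂ).submatrix (fun x => (x.2.1, x.1, x.2.2)) id

theorem exchangeMatrix_mem_unitaryGroup :
    exchangeMatrix A D ∈ Matrix.unitaryGroup (A × A × D) ℂ := by
  rw [Matrix.mem_unitaryGroup_iff, Matrix.star_eq_conjTranspose, exchangeMatrix,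
    Matrix.conjTranspose_submatrix, Matrix.conjTranspose_one,
    ← Matrix.submatrix_mul _ _ _ _ _ Function.bijective_id, one_mul]
  refine Matrix.submatrix_one _ fun x y h => ?_
  simp only [Prod.mk.injEq] at h
  exact Prod.ext h.2.1 (Prod.ext h.1 h.2.2)

theorem exchangeMatrix_mulVec (v : A × A × D → ℂ) (x : A × A × D) :
    (exchangeMatrix A D *ᵥ v) x = v (x.2.1, x.1, x.2.2) := by
  simp [exchangeMatrix, Matrix.mulVec, dotProduct, Matrix.one_apply]

/-- A state preparation: `V` acts on the first register, which is then exchanged with the second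
one, and `W` acts on the third register. -/
def prepMatrix (V : Matrix A A ℂ) (W : Matrix D D ℂ) : Matrix (A × A × D) (A × A × D) ℂ :=
  exchangeMatrix A D * ((Matrix.blockDiagonal fun _ => V)
    * ((1 : Matrix A A ℂ) ⊗ₖ ((1 : Matrix A A ℂ) ⊗ₖ W)))

/-- The exchange stores the oracle's output in the second register and leaves the first, on which
the oracle acts, in its initial state for the inner walks. -/
theorem prepMatrix_mulVec_ket (V : Matrix A A ℂ) (W : Matrix D D ℂ) (a : A) (d : D) :
    prepMatrix V W *ᵥ ket (a, a, d)
      = fun x => ket a x.1 * ((V *ᵥ ket a) x.2.1 * (W *ᵥ ket d) x.2.2) := by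
  have h1 : ((1 : Matrix A A ℂ) ⊗ₖ ((1 : Matrix A A ℂ) ⊗ₖ W)) *ᵥ ket (a, a, d)
      = fun x => ket a x.1 * (ket a x.2.1 * (W *ᵥ ket d) x.2.2) := by
    ext ⟨x, y, z⟩
    have e1 : (fun p : A × D => ket (a, a, d) (x, p)) = ket a x • ket (a, d) := by
      ext p; rw [ket_prod]; rfl
    have e2 : (fun q : D => ket (a, d) (y, q)) = ket a y • ket d := by
      ext q; rw [ket_prod]; rfl
    rw [one_kronecker_mulVec, e1, Matrix.mulVec_smul, Pi.smul_apply, one_kronecker_mulVec, e2,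
      Matrix.mulVec_smul, Pi.smul_apply]
    rfl
  ext ⟨x, y, z⟩
  rw [prepMatrix, ← Matrix.mulVec_mulVec, exchangeMatrix_mulVec, ← Matrix.mulVec_mulVec, h1,
    blockDiagonal_mulVec]
  have : (fun b => ket a b * (ket a x * (W *ᵥ ket d) z))
      = (ket a x * (W *ᵥ ket d) z) • ket a := by
    ext b; simp [mul_comm]
  simp only [this, Matrix.mulVec_smul, Pi.smul_apply, smul_eq_mul]
  ring

end Preparation

section OuterWalk

variable {k n : ℕ}

theorem prepMatrix_mem_unitaryGroup {M : ℕ} (U : Matrix.unitaryGroup (Fin k × Fin n) ℂ)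
    {W : Matrix (Fin (M + 1)) (Fin (M + 1)) ℂ}
    (hW : W ∈ Matrix.unitaryGroup (Fin (M + 1)) ℂ) :
    prepMatrix U.1 W ∈ Matrix.unitaryGroup _ ℂ := by
  refine mul_mem exchangeMatrix_mem_unitaryGroup (mul_mem ?_
    (Matrix.kronecker_mem_unitary (one_mem _) (Matrix.kronecker_mem_unitary (one_mem _) hW)))
  rw [Matrix.mem_unitaryGroup_iff, Matrix.star_eq_conjTranspose,
    Matrix.blockDiagonal_conjTranspose, ← Matrix.blockDiagonal_mul, ← Matrix.blockDiagonal_one]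
  congr 1
  ext1 y
  exact Matrix.mem_unitaryGroup_iff.mp U.2

theorem implementable_prepMatrix {C : Type} {M : ℕ} {W : Matrix (Fin (M + 1)) (Fin (M + 1)) ℂ}
    (hW : W ∈ Matrix.unitaryGroup (Fin (M + 1)) ℂ) :
    Implementable (C := C) (fun U : Matrix.unitaryGroup (Fin k × Fin n) ℂ =>
        Matrix.blockDiagonal fun _ : (Fin k × Fin n) × Fin (M + 1) => U.1) 1
      fun _ U => prepMatrix U.1 W :=
  (Implementable.gate (fun _ => exchangeMatrix (Fin k × Fin n) (Fin (M + 1)))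
    fun _ => exchangeMatrix_mem_unitaryGroup).mul (Implementable.call.mul
      (Implementable.gate (fun _ => (1 : Matrix (Fin k × Fin n) (Fin k × Fin n) ℂ) ⊗ₖ
        ((1 : Matrix (Fin k × Fin n) (Fin k × Fin n) ℂ) ⊗ₖ W)) fun _ =>
          Matrix.kronecker_mem_unitary (one_mem _) (Matrix.kronecker_mem_unitary (one_mem _) hW)))

/-- The mean, over the output distribution of the oracle, of a cosine polynomial. -/
noncomputable def cosMean (M : ℕ) (w : ℕ → ℝ) (p : Fin n → ℝ) : ℝ :=
  ∑ i, p i * ∑ m ∈ Finset.range (M + 1), w m * Real.cos (m * Real.arccos (1 - 2 * p i))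

variable [NeZero k] [NeZero n]

/-- The inner walks, controlled on a target in `Fin n` and on a degree. -/
noncomputable def controlledWalk (M : ℕ) (U : Matrix.unitaryGroup (Fin k × Fin n) ℂ) :
    Matrix ((Fin k × Fin n) × (Fin k × Fin n) × Fin (M + 1))
      ((Fin k × Fin n) × (Fin k × Fin n) × Fin (M + 1)) ℂ :=
  Matrix.blockDiagonal fun y => innerWalk U y.1.2 y.2

theorem controlledWalk_mul_self (M : ℕ) (U : Matrix.unitaryGroup (Fin k × Fin n) ℂ) :
    controlledWalk M U * controlledWalk M U = 1 := by
  rw [controlledWalk, ← Matrix.blockDiagonal_mul, ← Matrix.blockDiagonal_one]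
  congr 1
  ext1 y
  exact walk_pow_mul_reflectionMatrix_mul_self (markedReflection_conjTranspose U _)
    (markedReflection_mul_self U _) (star_ket_dotProduct_ket _) _

/-- The walk is block diagonal in (j, i, m), so its expectation averages the inner matrix elements
with weights |ψ(j, i)|² w m; summing over j yields the probability of i. -/
theorem star_dotProduct_controlledWalk (M : ℕ) (U : Matrix.unitaryGroup (Fin k × Fin n) ℂ)
    {w : ℕ → ℝ} {W : Matrix (Fin (M + 1)) (Fin (M + 1)) ℂ}
    (hW : ∀ m, ‖(W *ᵥ ket 0) m‖ ^ 2 = w m) :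
    star (prepMatrix U.1 W *ᵥ ket ((0, 0), (0, 0), 0))
        ⬝ᵥ (controlledWalk M U *ᵥ (prepMatrix U.1 W *ᵥ ket ((0, 0), (0, 0), 0)))
      = (cosMean M w (oracleProb U) : ℝ) := by
  rw [prepMatrix_mulVec_ket]
  set ψ := U.1 *ᵥ ket (0, 0) with hψ
  set μ := W *ᵥ ket 0 with hμ
  set χ : (Fin k × Fin n) × (Fin k × Fin n) × Fin (M + 1) → ℂ :=
    fun x => ket (0, 0) x.1 * (ψ x.2.1 * μ x.2.2) with hχ
  have h1 : ∀ a y, (controlledWalk M U *ᵥ χ) (a, y)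
      = (innerWalk U y.1.2 y.2 *ᵥ ket (0, 0)) a * (ψ y.1 * μ y.2) := by
    intro a y
    rw [controlledWalk, blockDiagonal_mulVec]
    have : (fun b => χ (b, y)) = (ψ y.1 * μ y.2) • ket (0, 0) := by
      ext b; simp [hχ, mul_comm]
    rw [this, Matrix.mulVec_smul, Pi.smul_apply, smul_eq_mul, mul_comm]
  rw [dotProduct, Fintype.sum_prod_type, Finset.sum_eq_single (0, 0)]
  · have h2 : ∀ y : (Fin k × Fin n) × Fin (M + 1),
        star χ ((0, 0), y) * (controlledWalk M U *ᵥ χ) ((0, 0), y)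
          = ((‖ψ y.1‖ ^ 2 * (w y.2
            * Real.cos (y.2 * Real.arccos (1 - 2 * oracleProb U y.1.2))) : ℝ) : ℂ) := by
      intro y
      rw [h1, innerWalk_mulVec_ket, ← hW]
      have : star χ ((0, 0), y) = star (ψ y.1) * star (μ y.2) := by
        simp [hχ, ket]
      rw [this, Complex.star_def]
      push_cast
      rw [← Complex.conj_mul', ← Complex.conj_mul']
      ring
    rw [Finset.sum_congr rfl fun y _ => h2 y, ← Complex.ofReal_sum, cosMean]
    congr 1
    rw [Fintype.sum_prod_type, Fintype.sum_prod_type_right]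
    refine Finset.sum_congr rfl fun i _ => ?_
    change ∑ x, ∑ y : Fin (M + 1), ‖ψ (x, i)‖ ^ 2
        * (w y * Real.cos (y * Real.arccos (1 - 2 * oracleProb U i)))
      = (∑ x, ‖ψ (x, i)‖ ^ 2) * _
    rw [Finset.sum_range, Finset.sum_mul_sum]
  · intro a _ ha
    refine Finset.sum_eq_zero fun y _ => ?_
    have : star χ (a, y) = 0 := by simp [hχ, ket, ha]
    rw [this, zero_mul]
  · simp

/-- The walk whose orbits encode `cosMean`. -/
noncomputable def outerWalk {M : ℕ} (W : Matrix (Fin (M + 1)) (Fin (M + 1)) ℂ)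
    (U : Matrix.unitaryGroup (Fin k × Fin n) ℂ) :
    Matrix ((Fin k × Fin n) × (Fin k × Fin n) × Fin (M + 1))
      ((Fin k × Fin n) × (Fin k × Fin n) × Fin (M + 1)) ℂ :=
  reflectionMatrix (prepMatrix U.1 W *ᵥ ket ((0, 0), (0, 0), 0)) * controlledWalk M U

/-- A step costs 2M calls for the controlled inner walks and 2 for the preparation and its inverse
around a fixed reflection. Inactive steps cancel to the identity. -/
theorem implementable_outerWalk_pow {C : Type} {M : ℕ}
    {W : Matrix (Fin (M + 1)) (Fin (M + 1)) ℂ}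
    (hW : W ∈ Matrix.unitaryGroup (Fin (M + 1)) ℂ) (m : C → ℕ) (T : ℕ) (hm : ∀ c, m c ≤ T) :
    Implementable (fun U : Matrix.unitaryGroup (Fin k × Fin n) ℂ =>
        Matrix.blockDiagonal fun _ : (Fin k × Fin n) × Fin (M + 1) => U.1) (T * (2 * M + 2))
      fun c U => outerWalk W U ^ m c := by
  have hstep : ∀ Q : C → Prop, ∀ [DecidablePred Q],
      Implementable (fun U : Matrix.unitaryGroup (Fin k × Fin n) ℂ =>
        Matrix.blockDiagonal fun _ : (Fin k × Fin n) × Fin (M + 1) => U.1) (2 * M + 2)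
        fun c U => if Q c then outerWalk W U else 1 := by
    intro Q _
    have hS := (implementable_innerWalk (k := k) (n := n)
      (fun c : C × ((Fin k × Fin n) × Fin (M + 1)) => Q c.1) (fun c => c.2.1.2)
      (fun c => c.2.2) M (fun c => Nat.lt_succ_iff.mp c.2.2.2)).blockDiagonal
    have hB := implementable_prepMatrix (k := k) (n := n) (C := C) hW
    have hg := Implementable.gate (L := fun U : Matrix.unitaryGroup (Fin k × Fin n) ℂ =>
        Matrix.blockDiagonal fun _ : (Fin k × Fin n) × Fin (M + 1) => U.1)
      (fun c => if Q c then reflectionMatrix (ket ((0, 0), (0, 0), 0)) else 1)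
      (fun c => by
        split_ifs
        exacts [reflectionMatrix_mem_unitaryGroup (star_ket_dotProduct_ket _), one_mem _])
    have h := ((hB.mul hg).mul hB.conjTranspose).mul hS
    convert h using 1
    · ring
    ext1 c
    ext1 U
    have hU := prepMatrix_mem_unitaryGroup U hW
    by_cases hQ : Q c
    · simp only [if_pos hQ, mul_reflectionMatrix_mul_conjTranspose hU]
      rfl
    · simp only [if_neg hQ, mul_one]
      rw [← Matrix.star_eq_conjTranspose, Matrix.mem_unitaryGroup_iff.mp hU, one_mul]
      exact Matrix.blockDiagonal_one.symm
  convert Implementable.pow_min hstep m T using 3 with c U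
  rw [min_eq_right (hm c)]

end OuterWalk

/-! ### Phase estimation of the outer walk. -/

/-- Basis labels of the oracle registers, of their copy, and of the degree register. -/
abbrev WalkRegister (k n M : ℕ) : Type := (Fin k × Fin n) × (Fin k × Fin n) × Fin (M + 1)

/-- Chebyshev's inequality for the phase estimation circuit: the cosine of the measured frequency is
an estimate of `cosMean`. -/
theorem exists_cosMean_estimator (k n : ℕ) [NeZero k] [NeZero n] (M T : ℕ) [NeZero T] {w : ℕ → ℝ}
    (hw : ∀ m, 0 ≤ w m) (hw1 : ∑ m ∈ Finset.range (M + 1), w m = 1) {α : ℕ → ℝ} (h0 : α 0 = 0)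
    (hT : α T = 0) (hα : ∑ t : Fin T, α t ^ 2 = 1) (f : ℝ → ℝ) :
    ∃ alg : QueryAlgorithm k n, alg.queryCount = T * (2 * M + 2) + 1 ∧
      ∀ (U : Matrix.unitaryGroup (Fin k × Fin n) ℂ) (δ : ℝ) (S : Set ℝ), 0 < δ →
        (∀ y, |y - cosMean M w (oracleProb U)| ≤ δ → f y ∈ S) →
          1 - (∑ t ∈ Finset.range T, (α (t + 1) - α t) ^ 2) / δ ^ 2 ≤ alg.outputProb U S := by
  obtain ⟨W, hWu, hW⟩ := exists_unitary_mulVec_ket (0 : Fin (M + 1))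
    (v := fun m => ((Real.sqrt (w m) : ℝ) : ℂ)) (by
      simp only [Complex.norm_real, Real.norm_eq_abs, sq_abs, Real.sq_sqrt (hw _)]
      rw [← hw1, Finset.sum_range])
  have hW2 : ∀ m, ‖(W *ᵥ ket 0) m‖ ^ 2 = w m := by
    intro m
    rw [hW, Complex.norm_real, Real.norm_eq_abs, sq_abs, Real.sq_sqrt (hw _)]
  obtain ⟨K, hKu, hK⟩ := exists_unitary_mulVec_ket (0 : Fin T)
    (v := fun t => (α t : ℂ)) (by simpa [Complex.norm_real] using hα)
  obtain ⟨x₀, hx₀⟩ : ∃ x₀ : WalkRegister k n M, x₀ = ((0, 0), (0, 0), 0) := ⟨_, rfl⟩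
  obtain ⟨N, hN⟩ : ∃ N, Fintype.card (((Fin k × Fin n) × Fin (M + 1)) × Fin T) = N + 1 :=
    Nat.exists_eq_succ_of_ne_zero Fintype.card_ne_zero
  -- All ancillas are packed into one workspace; the swap makes its label 0 the initial label of
  -- every ancilla.
  obtain ⟨g, hg⟩ : ∃ g : Fin (N + 1) ≃ ((Fin k × Fin n) × Fin (M + 1)) × Fin T,
       g 0 = (((0, 0), 0), 0) := by
    let g₀ := (Fintype.equivFinOfCardEq hN).symm
    exact ⟨g₀.trans (Equiv.swap (g₀ 0) (((0, 0), 0), 0)), by simp⟩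
  obtain ⟨e, he'⟩ : ∃ e : Register k n (N + 1) ≃ WalkRegister k n M × Fin T,
      ∀ a b, e (a, b) = ((a, (g b).1), (g b).2) :=
    ⟨((Equiv.refl _).prodCongr g).trans
      (((Equiv.prodAssoc (Fin k × Fin n) ((Fin k × Fin n) × Fin (M + 1)) (Fin T))).symm),
      fun _ _ => rfl⟩
  have he : e ((0, 0), 0) = (x₀, 0) := by rw [he', hg, hx₀]
  -- From right to left: K loads the window into the clock, the state is prepared and t walk steps
  -- are made in branch t, then the clock is Fourier transformed.
  have himp := (((Implementable.gate (C := Unit) (fun _ => (1 : Matrix (WalkRegister k n M) _ ℂ) ⊗ₖ fourierMatrix T)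
    fun _ => Matrix.kronecker_mem_unitary (one_mem _) (fourierMatrix_mem_unitaryGroup T)).mul
    ((implementable_outerWalk_pow (k := k) (n := n) hWu (fun c : Unit × Fin T => c.2.val) T
      fun c => c.2.2.le).mul (implementable_prepMatrix hWu)).blockDiagonal).mul
    (Implementable.gate (fun _ => (1 : Matrix (WalkRegister k n M) _ ℂ) ⊗ₖ K)
      fun _ => Matrix.kronecker_mem_unitary (one_mem _) hKu))
  obtain ⟨c, hc, hcU⟩ := himp.exists_circuit e (by
    intro U
    ext ⟨a, b⟩ ⟨a', b'⟩
    have hg' : b = b' ↔ (g b).1 = (g b').1 ∧ (g b).2 = (g b').2 := by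
      rw [← Prod.ext_iff, g.injective.eq_iff]
    simp only [he', liftOracle, Matrix.submatrix_apply, Matrix.blockDiagonal_apply,
      Matrix.kroneckerMap_apply, Matrix.one_apply, mul_ite, mul_one, mul_zero, hg']
    split_ifs <;> simp_all)
  refine ⟨⟨N, c, fun x => f (Real.cos (2 * Real.pi * (e x).2 / T))⟩, ?_, ?_⟩
  · rw [QueryAlgorithm.queryCount, hc]; ring
  intro U δ S hδ hS
  set A := cosMean M w (oracleProb U) with hA
  set χ := prepMatrix U.1 W *ᵥ ket x₀ with hχ
  set Ψ : WalkRegister k n M × Fin T → ℂ := fun y =>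
    (fourierMatrix T *ᵥ fun t => α t * (outerWalk W U ^ (t : ℕ) *ᵥ χ) y.1) y.2 with hΨ
  have hfinal : ∀ x, (circuitEval U c).1 x ((0, 0), 0) = Ψ (e x) := by
    intro x
    rw [hcU, Matrix.submatrix_apply, he]
    generalize e x = y
    obtain ⟨x, j⟩ := y
    have h1 : ((1 : Matrix (WalkRegister k n M) _ ℂ) ⊗ₖ K) *ᵥ ket (x₀, 0) = fun y => (α y.2 : ℂ) * ket x₀ y.1 := by
      ext ⟨y, t⟩
      have h2 : (fun q : Fin T => ket (x₀, (0 : Fin T)) (y, q)) = ket x₀ y • ket 0 := by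
        ext q; rw [ket_prod]; rfl
      rw [one_kronecker_mulVec, h2, Matrix.mulVec_smul, Pi.smul_apply, hK, smul_eq_mul, mul_comm]
    refine (congrFun (mulVec_ket _ (x₀, (0 : Fin T))) (x, j)).symm.trans ?_
    rw [← Matrix.mulVec_mulVec, ← Matrix.mulVec_mulVec, h1, one_kronecker_mulVec, hΨ]
    congr 2
    ext t
    rw [blockDiagonal_mulVec]
    have h3 : (fun y => (α t : ℂ) * ket x₀ y) = (α t : ℂ) • ket x₀ := rfl
    simp only [h3, Matrix.mulVec_smul, Pi.smul_apply, smul_eq_mul]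
    rw [← Matrix.mulVec_mulVec]
  have hχ1 : star χ ⬝ᵥ χ = 1 := by
    rw [hχ, star_dotProduct_mulVec_self (prepMatrix_mem_unitaryGroup U hWu),
      star_ket_dotProduct_ket]
  have hR : outerWalk W U = reflectionMatrix χ * controlledWalk M U := by
    rw [outerWalk, hχ, hx₀]
  have hA' : star χ ⬝ᵥ (controlledWalk M U *ᵥ χ) = A := by
    rw [hχ, hx₀, star_dotProduct_controlledWalk M U hW2]
  have hrec : ∀ x t, (outerWalk W U ^ (t + 2) *ᵥ χ) x + (outerWalk W U ^ t *ᵥ χ) x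
      = 2 * A * (outerWalk W U ^ (t + 1) *ᵥ χ) x := by
    intro x t
    have h := congrFun (walk_recurrence (controlledWalk_mul_self M U) hχ1 t) x
    rw [hA', ← hR] at h
    exact h
  have horbit : ∀ t, ∑ x, ‖(outerWalk W U ^ t *ᵥ χ) x‖ ^ 2 = 1 := by
    intro t
    have hcw : controlledWalk M U ∈ Matrix.unitaryGroup (WalkRegister k n M) ℂ := by
      have h := controlledWalk_mul_self M U
      rw [Matrix.mem_unitaryGroup_iff, Matrix.star_eq_conjTranspose]
      have h' : (controlledWalk M U)ᴴ = controlledWalk M U := by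
        rw [controlledWalk, Matrix.blockDiagonal_conjTranspose]
        congr 1
        ext1 y
        exact walk_pow_mul_reflectionMatrix_conjTranspose (markedReflection_conjTranspose U _) _ _
      rw [h', h]
    have hmem : outerWalk W U ^ t ∈ Matrix.unitaryGroup (WalkRegister k n M) ℂ := by
      rw [hR]
      exact pow_mem (mul_mem (reflectionMatrix_mem_unitaryGroup hχ1) hcw) t
    have h := star_dotProduct_mulVec_self hmem χ
    rw [hχ1, star_dotProduct_self] at h
    exact_mod_cast h
  -- The scalar bound is applied to each coordinate of the orbit; since the orbit consists of unit
  -- vectors, the sum over coordinates leaves only the window energy.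
  have hvar : ∑ y : WalkRegister k n M × Fin T, ‖Ψ y‖ ^ 2 * (Real.cos (2 * Real.pi * y.2 / T) - A) ^ 2
      ≤ ∑ t ∈ Finset.range T, (α (t + 1) - α t) ^ 2 := by
    rw [Fintype.sum_prod_type]
    refine (Finset.sum_le_sum fun x _ => sum_norm_sq_fourierMatrix_mul_le h0 hT
      (u := fun t => (outerWalk W U ^ t *ᵥ χ) x) (hrec x)).trans (le_of_eq ?_)
    rw [Finset.sum_comm]
    refine Finset.sum_congr rfl fun t _ => ?_
    rw [← Finset.mul_sum, ← Finset.sum_div, Finset.sum_add_distrib, horbit, horbit]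
    ring
  have hone : ∑ y : WalkRegister k n M × Fin T, ‖Ψ y‖ ^ 2 = 1 := by
    rw [Fintype.sum_prod_type]
    simp only [hΨ, sum_norm_sq_mulVec (fourierMatrix_mem_unitaryGroup T)]
    rw [Finset.sum_comm]
    simp only [norm_mul, mul_pow, Complex.norm_real, Real.norm_eq_abs, sq_abs]
    simp only [← Finset.mul_sum, horbit, mul_one, hα]
  classical
  rw [QueryAlgorithm.outputProb]
  simp only [QueryAlgorithm.finalState, mulVec_ket, hfinal]
  rw [Finset.sum_filter, e.sum_comp
    (fun y => if f (Real.cos (2 * Real.pi * y.2 / T)) ∈ S then ‖Ψ y‖ ^ 2 else 0), sub_le_iff_le_add,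
    ← hone]
  -- Chebyshev's inequality: each outcome outside S deviates by at least δ, so its weight is at most
  -- its share of the second moment over δ².
  refine le_trans ?_ (add_le_add_right (div_le_div_of_nonneg_right hvar (sq_nonneg δ)) _)
  rw [Finset.sum_div, ← Finset.sum_add_distrib]
  refine Finset.sum_le_sum fun y _ => ?_
  split_ifs with hy
  · have : 0 ≤ ‖Ψ y‖ ^ 2 * (Real.cos (2 * Real.pi * y.2 / T) - A) ^ 2 / δ ^ 2 := by positivity
    linarith
  · have h1 : δ ≤ |Real.cos (2 * Real.pi * y.2 / T) - A| := by
      by_contra h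
      exact hy (hS _ (not_le.mp h).le)
    have h2 : δ ^ 2 ≤ (Real.cos (2 * Real.pi * y.2 / T) - A) ^ 2 := by
      rw [← sq_abs (_ - A)]
      exact pow_le_pow_left₀ hδ.le h1 2
    rw [zero_add, le_div_iff₀ (by positivity)]
    gcongr

/-! ### Choice of parameters and conclusion. -/

theorem exists_constant_algorithm (k n : ℕ) [NeZero k] [NeZero n] (h : ℝ) :
    ∃ alg : QueryAlgorithm k n, alg.queryCount = 0 ∧
      ∀ (U : Matrix.unitaryGroup (Fin k × Fin n) ℂ) (S : Set ℝ), h ∈ S →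
        alg.outputProb U S = 1 := by
  refine ⟨⟨0, [], fun _ => h⟩, rfl, fun U S hS => ?_⟩
  have := star_ket_dotProduct_ket (((0, 0), 0) : Register k n 1)
  rw [star_dotProduct_self] at this
  simp only [QueryAlgorithm.outputProb, QueryAlgorithm.finalState, circuitEval, hS,
    Finset.filter_true, OneMemClass.coe_one, Matrix.one_mulVec]
  exact_mod_cast this

/-- Entropy estimation with explicit parameters: the degree `M` of the cosine polynomial, the radius
`r` and the number `2 * L` of steps of phase estimation. -/
theorem exists_entropy_estimator (k n : ℕ) [NeZero k] [NeZero n] {M L : ℕ} {r ε : ℝ}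
    (hr0 : 1 / 2 ≤ r) (hr1 : r < 1) (hM : 0 < M) (hε : 0 < ε)
    (happrox : 2 * (r ^ (M + 1) * (1 - r)⁻¹ / (M + 1)) + n * (1 - r) ^ 2 / 2 ≤ ε / 2)
    (hL : 20 * -Real.log (1 - r) / ε ≤ L) :
    ∃ alg : QueryAlgorithm k n, alg.queryCount = 2 * L * (2 * M + 2) + 1 ∧
      ∀ (p : Fin n → ℝ) (U : Matrix.unitaryGroup (Fin k × Fin n) ℂ),
        p ∈ stdSimplex ℝ (Fin n) → IsPurifiedOracle p U →
          2 / 3 ≤ alg.outputProb U {h : ℝ | |h - shannonEntropy p| ≤ ε} := by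
  set Λ := ∑ m ∈ Finset.range (M + 1), r ^ m / m with hΛ
  have hr : 0 < r := by linarith
  have hΛ0 : 0 < Λ := by
    refine Finset.sum_pos' (fun m _ => by positivity) ⟨1, ?_, by simpa using hr⟩
    simpa using hM
  have hΛ1 : Λ ≤ -Real.log (1 - r) := sum_pow_div_le_neg_log hr.le hr1 M
  have hLΛ : 20 * Λ / ε ≤ L := le_trans (by gcongr) hL
  have hL0 : (0 : ℝ) < L := lt_of_lt_of_le (by positivity) hLΛ
  have hLpos : 0 < L := by exact_mod_cast hL0
  have : NeZero (2 * L) := ⟨by omega⟩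
  obtain ⟨α, h0, hT, hα, hΔ⟩ := exists_window hLpos
  obtain ⟨alg, hcount, halg⟩ := exists_cosMean_estimator k n M (2 * L)
    (w := fun m => r ^ m / m / Λ) (fun m => by positivity)
    (by rw [← Finset.sum_div, ← hΛ, div_self hΛ0.ne']) h0 hT hα
    (fun y => 2 * Λ * y + Real.log (4 * r))
  refine ⟨alg, hcount, fun p U hp hU => ?_⟩
  have hpU : oracleProb U = p := funext fun i => hU.oracleProb_eq hp.1 i
  -- The output rescales y by 2Λ, so this precision contributes ε/2 to the error. Since Lδ ≥ 5, the
  -- failure probability is at most 6/25 < 1/3.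
  have hδ : 0 < ε / (4 * Λ) := by positivity
  refine le_trans ?_ (halg U (ε / (4 * Λ)) _ hδ fun y hy => ?_)
  · have h1 : (∑ t ∈ Finset.range (2 * L), (α (t + 1) - α t) ^ 2) / (ε / (4 * Λ)) ^ 2
        ≤ 6 / (L : ℝ) ^ 2 / (ε / (4 * Λ)) ^ 2 := by gcongr
    have h2 : 5 ≤ L * (ε / (4 * Λ)) := by
      rw [div_le_iff₀ hε] at hLΛ
      rw [mul_div_assoc', le_div_iff₀ (by positivity)]
      linarith
    have h3 : 6 / (L : ℝ) ^ 2 / (ε / (4 * Λ)) ^ 2 ≤ 1 / 3 := by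
      rw [div_div, ← mul_pow, div_le_div_iff₀ (by positivity) (by norm_num)]
      nlinarith
    linarith
  · rw [hpU] at hy
    have happ := abs_entropy_sub_le hp hr0 hr1 M
    have hmean : Λ * cosMean M (fun m => r ^ m / m / Λ) p
        = ∑ i, p i * ∑ m ∈ Finset.range (M + 1),
          r ^ m / m * Real.cos (m * Real.arccos (1 - 2 * p i)) := by
      rw [cosMean, Finset.mul_sum]
      refine Finset.sum_congr rfl fun i _ => ?_
      rw [mul_left_comm, Finset.mul_sum]
      congr 1
      refine Finset.sum_congr rfl fun m _ => ?_
      field_simp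
    rw [← hmean] at happ
    set a := cosMean M (fun m => r ^ m / m / Λ) p
    have hya : |2 * Λ * (y - a)| ≤ ε / 2 := by
      rw [abs_mul, abs_of_pos (by positivity)]
      calc _ ≤ 2 * Λ * (ε / (4 * Λ)) := by gcongr
        _ = ε / 2 := by field_simp; norm_num
    rw [Set.mem_ofPred_eq]
    have hsplit : 2 * Λ * y + Real.log (4 * r) - shannonEntropy p
        = 2 * Λ * (y - a) + (2 * (Λ * a) + Real.log (4 * r) - shannonEntropy p) := by ring
    rw [hsplit]
    refine (abs_add_le _ _).trans ?_
    linarith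

/-- The parameters that make the estimator both accurate and cheap. -/
theorem exists_estimator_parameters {n : ℕ} (hn : 2 ≤ n) {ε : ℝ} (h0 : 0 < ε) (h1 : ε < 1)
    (hlog : 2 ≤ Real.log n / ε) :
    ∃ (r : ℝ) (M L : ℕ), 1 / 2 ≤ r ∧ r < 1 ∧ 0 < M ∧
      2 * (r ^ (M + 1) * (1 - r)⁻¹ / (M + 1)) + n * (1 - r) ^ 2 / 2 ≤ ε / 2 ∧
      20 * -Real.log (1 - r) / ε ≤ L ∧
      (2 * L * (2 * M + 2) + 1 : ℝ) ≤ 10000 * (Real.sqrt n / ε ^ (3 / 2 : ℝ)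
        * Real.log (n / ε) ^ (3 / 2 : ℝ) * Real.posLog (Real.log n / ε)) := by
  have hn2 : (2 : ℝ) ≤ n := by exact_mod_cast hn
  have hl2 := Real.log_two_gt_d9
  have hl2' := Real.log_two_lt_d9
  set X := Real.log (n / ε) with hX
  set Y := Real.posLog (Real.log n / ε) with hY
  -- With 1 - r = η, the regularisation bias n η²/2 equals ε/4.
  set η := Real.sqrt (ε / (2 * n)) with hη
  have hηsq : η ^ 2 = ε / (2 * n) := Real.sq_sqrt (by positivity)
  have hη0 : 0 < η := Real.sqrt_pos.mpr (by positivity)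
  have hη1 : η ≤ 1 / 2 := by
    have : η ^ 2 ≤ (1 / 2) ^ 2 := by
      rw [hηsq, div_le_iff₀ (by positivity)]; linarith
    exact (pow_le_pow_iff_left₀ hη0.le (by norm_num) (by norm_num)).mp this
  have hX2 : Real.log 2 ≤ X := by
    apply Real.log_le_log (by norm_num)
    rw [le_div_iff₀ h0]; nlinarith
  have hlogη : -Real.log η ≤ X := by
    have e1 : Real.log (η ^ 2) = -(Real.log 2 + X) := by
      rw [hηsq, hX, ← Real.log_mul (by norm_num) (by positivity), ← Real.log_inv]
      congr 1
      field_simp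
    rw [Real.log_pow] at e1
    push_cast at e1
    linarith
  -- Chosen so that r^M ≤ exp(-ℓ) = ε/8 once Mη ≥ ℓ. As ℓ ≥ 1, the factor 1/(η(M + 1)) is at most 1,
  -- and the truncation error stays below ε/4.
  set ℓ := Real.log (8 / ε) with hℓ
  have hℓeq : ℓ = 3 * Real.log 2 + -Real.log ε := by
    rw [hℓ, Real.log_div (by norm_num) h0.ne', show (8 : ℝ) = 2 ^ 3 by norm_num, Real.log_pow]
    push_cast; ring
  have hlogε : Real.log ε < 0 := Real.log_neg h0 h1
  have hℓ1 : 1 ≤ ℓ := by rw [hℓeq]; linarith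
  have hY1 : Y = Real.log (Real.log n / ε) :=
    Real.posLog_eq_log (by rw [abs_of_nonneg (by linarith)]; linarith)
  have hY2 : Real.log 2 ≤ Y := by rw [hY1]; exact Real.log_le_log (by norm_num) hlog
  have hlogn : Real.log 2 ≤ Real.log n := Real.log_le_log (by norm_num) hn2
  have hY3 : -Real.log 2 - Real.log ε ≤ Y := by
    rw [hY1, Real.log_div (by linarith) h0.ne', ← Real.log_inv]
    have : Real.log 2⁻¹ ≤ Real.log (Real.log n) :=
      Real.log_le_log (by norm_num) (by norm_num; linarith)
    linarith
  -- Four copies of ln 2 ≤ Y are added to -ln 2 - ln ε ≤ Y.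
  have hℓY : ℓ ≤ 5 * Y := by rw [hℓeq]; linarith
  have hℓ0 : 0 < ℓ := by linarith
  have hX0 : 0 < X := by linarith
  set M := ⌈ℓ / η⌉₊ with hM
  set L := ⌈20 * X / ε⌉₊ with hL
  have hM1 : ℓ / η ≤ M := Nat.le_ceil _
  have hM2 : (M : ℝ) ≤ ℓ / η + 1 := (Nat.ceil_lt_add_one (by positivity)).le
  have hL1 : 20 * X / ε ≤ L := Nat.le_ceil _
  have hL2 : (L : ℝ) ≤ 20 * X / ε + 1 := (Nat.ceil_lt_add_one (by positivity)).le
  have hMη : ℓ ≤ M * η := by rwa [div_le_iff₀ hη0] at hM1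
  refine ⟨1 - η, M, L, by linarith, by linarith, Nat.ceil_pos.mpr (by positivity), ?_, ?_, ?_⟩
  · rw [sub_sub_cancel]
    have e1 : (1 - η) ^ (M + 1) ≤ ε / 8 := by
      calc (1 - η) ^ (M + 1) ≤ (1 - η) ^ M :=
            pow_le_pow_of_le_one (by linarith) (by linarith) (Nat.le_succ M)
        _ ≤ Real.exp (-η) ^ M := by
            gcongr
            · linarith
            · linarith [Real.add_one_le_exp (-η)]
        _ = Real.exp (-(M * η)) := by rw [← Real.exp_nat_mul]; ring_nf
        _ ≤ Real.exp (-ℓ) := by gcongr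
        _ = ε / 8 := by
            rw [hℓ, ← Real.log_inv, Real.exp_log (by positivity)]; field_simp
    have e2 : (1 - η) ^ (M + 1) * η⁻¹ / (M + 1) ≤ ε / 8 := by
      rw [← div_eq_mul_inv, div_div, div_le_iff₀ (by positivity)]
      nlinarith
    have e3 : n * η ^ 2 / 2 = ε / 4 := by rw [hηsq]; field_simp; norm_num
    linarith
  · rw [sub_sub_cancel]
    refine le_trans ?_ hL1
    gcongr
  · have hsn : 0 < Real.sqrt n := Real.sqrt_pos.mpr (by positivity)
    have hse : 0 < Real.sqrt ε := Real.sqrt_pos.mpr h0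
    have hηeq : η⁻¹ ≤ 2 * (Real.sqrt n / Real.sqrt ε) := by
      rw [hη, Real.sqrt_div h0.le, Real.sqrt_mul (by norm_num), inv_div, mul_div_assoc]
      gcongr
      exact Real.sqrt_le_iff.mpr ⟨by norm_num, by norm_num⟩
    have hpow : ∀ x : ℝ, 0 ≤ x → x ^ (3 / 2 : ℝ) = x * Real.sqrt x := by
      intro x hx
      rw [Real.sqrt_eq_rpow, show (3 / 2 : ℝ) = 1 + 1 / 2 by norm_num,
        Real.rpow_add_of_nonneg hx (by norm_num) (by norm_num), Real.rpow_one]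
    -- The cost involves only the first power of X; the remaining √X in the bound is absorbed
    -- through this lower estimate, valid since X ≥ ln 2.
    have hsX : 4 / 5 ≤ Real.sqrt X := Real.le_sqrt_of_sq_le (by norm_num; linarith)
    rw [hpow ε h0.le, hpow X hX0.le]
    set Q := Real.sqrt n / Real.sqrt ε with hQ
    have hQ0 : 0 < Q := by positivity
    have hQ1 : 1 ≤ η⁻¹ := (one_le_inv₀ hη0).mpr (by linarith)
    have m1 : ℓ / η ≤ 10 * (Y * Q) := by
      rw [div_eq_mul_inv]
      calc ℓ * η⁻¹ ≤ (5 * Y) * (2 * Q) := by gcongr; linarith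
        _ = _ := by ring
    have m2 : 1 ≤ ℓ / η := by rw [div_eq_mul_inv]; nlinarith
    have m3 : 2 * (M : ℝ) + 2 ≤ 60 * (Y * Q) := by linarith
    have l1 : 1 ≤ 2 * (X / ε) := by
      rw [mul_div_assoc', le_div_iff₀ h0]; linarith
    have l2 : (L : ℝ) ≤ 22 * (X / ε) := by
      rw [mul_div_assoc] at hL2; linarith
    have hYQ : 1 ≤ 10 * (Y * Q) := by linarith
    have hY0 : 0 < Y := by linarith
    have hprod : 2 * (L : ℝ) * (2 * M + 2) ≤ 2 * (22 * (X / ε)) * (60 * (Y * Q)) := by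
      gcongr
    have hone : 1 ≤ (2 * (X / ε)) * (10 * (Y * Q)) := one_le_mul_of_one_le_of_one_le l1 hYQ
    have hpos : 0 < (X / ε) * (Y * Q) := by positivity
    -- 2660 = 2·22·60 + 2·10, the last summand accounting for the single extra query.
    calc (2 * L * (2 * M + 2) + 1 : ℝ) ≤ 2660 * ((X / ε) * (Y * Q)) := by linarith
      _ ≤ 10000 * ((X / ε) * (Y * Q)) * (4 / 5) := by linarith
      _ ≤ 10000 * ((X / ε) * (Y * Q)) * Real.sqrt X := by gcongr
      _ = _ := by rw [hQ]; field_simp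

theorem mainTheorem1 :
    ∃ C : ℝ, 0 < C ∧ ∀ (n k : ℕ) [NeZero n] [NeZero k] (ε : ℝ), 0 < ε → ε < 1 →
      ∃ alg : QueryAlgorithm k n,
        (alg.queryCount : ℝ) ≤
          C * (Real.sqrt n / ε ^ (3 / 2 : ℝ) * Real.log (n / ε) ^ (3 / 2 : ℝ)
            * Real.posLog (Real.log n / ε)) ∧
        ∀ (p : Fin n → ℝ) (U : Matrix.unitaryGroup (Fin k × Fin n) ℂ),
          p ∈ stdSimplex ℝ (Fin n) → IsPurifiedOracle p U →
            2 / 3 ≤ alg.outputProb U {h : ℝ | |h - shannonEntropy p| ≤ ε} := by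
  refine ⟨10000, by norm_num, fun n k _ _ ε h0 h1 => ?_⟩
  have hn1 : 1 ≤ n := Nat.one_le_iff_ne_zero.mpr (NeZero.ne n)
  have hn1' : (1 : ℝ) ≤ n := by exact_mod_cast hn1
  -- Below 2 the factor log⁺ may vanish, so no query is allowed; there 0 ≤ H ≤ ln n < 2ε, and the
  -- midpoint is within ε.
  rcases lt_or_ge (Real.log n / ε) 2 with hlog | hlog
  · obtain ⟨alg, hcount, halg⟩ := exists_constant_algorithm k n (Real.log n / 2)
    refine ⟨alg, ?_, fun p U hp _ => ?_⟩
    · rw [hcount, Nat.cast_zero]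
      have hX : 0 ≤ Real.log (n / ε) := Real.log_nonneg (by rw [le_div_iff₀ h0]; linarith)
      have := Real.posLog_nonneg (x := Real.log n / ε)
      positivity
    · rw [halg U]
      · norm_num
      · rw [div_lt_iff₀ h0] at hlog
        have e0 := shannonEntropy_nonneg hp
        have e1 := shannonEntropy_le_log hp
        rw [Set.mem_ofPred_eq, abs_le]
        constructor <;> linarith
  · have hn2 : 2 ≤ n := by
      by_contra h
      have : n = 1 := by omega
      rw [this] at hlog
      norm_num at hlog
    obtain ⟨r, M, L, hr0, hr1, hM, happ, hL, hbound⟩ := exists_estimator_parameters hn2 h0 h1 hlog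
    obtain ⟨alg, hcount, halg⟩ := exists_entropy_estimator k n hr0 hr1 hM h0 happ hL
    refine ⟨alg, ?_, halg⟩
    rw [hcount]
    exact_mod_cast hbound
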